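/- Let $n\ge 2$ be an integer and let $1<p\le n$ be real. Then there is a compact set $E\subset B(0,2)\cap\big([0,1]^{n-1}\times\{0\}\big)\subset\mathbb R^n$ (for $n=2$: a compact subset of the segment $[0,1]\times\{0\}$) such that $\Omega:=B(0,2)\setminus E$ has the following properties. Write $\rho(x)=\operatorname{dist}(x,\partial\Omega)$. (a) $\Omega$ is a John domain with some distinguished point $x_0\in\Omega$: $\Omega$ is a bounded domain and there is $C>0$ such that every $x\in\Omega$ can be joined to $x_0$ by a curve $\gamma:[0,l]\to\Omega$, parametrised by arclength, with $\gamma(0)=x$, $\gamma(l)=x_0$ and $\operatorname{dist}(\gamma(t),\mathbb R^n\setminus\Omega)\ge Ct$ for all $0\le t\le l$. (b) $\Omega$ has the separation property with respect to the same $x_0$: there is $C_s>0$ such that every $x\in\Omega$ can be joined to $x_0$ by a curve $\gamma:[0,1]\to\Omega$, $\gamma(0)=x$, $\gamma(1)=x_0$, such that for each $t\in[0,1]$, with $B:=B(\gamma(t),C_s\rho(\gamma(t)))$, either $\gamma([0,t])\subset B$, or each $y\in\gamma([0,t])\setminus B$ belongs to a component of $\Omega\setminus\partial B$ that does not contain $x_0$.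 (c) There are $f\in L^p(\Omega)$ with $\int_\Omega f\,dx=0$ and $\mathbf v\in W^{1,p}_0(\Omega)^n$, where $W^{1,p}_0(\Omega)$ is the closure of $C_c^\infty(\Omega)$ in $W^{1,p}(\Omega)$, such that $\operatorname{div}\mathbf v=f$ in the sense that $$\int_\Omega \mathbf v\cdot\nabla g\,dx=-\int_\Omega f g\,dx\qquad\text{for all } g\in W^{1,q}(\Omega),\quad q=\tfrac{p}{p-1},$$ and yet $$\Big\|\frac{\mathbf v}{\rho}\Big\|_{L^p(\Omega)^n}=\infty .$$ -/

import Mathlib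

open MeasureTheory Filter Topology Set
open scoped ContDiff

/-- `Ω` is a John domain with distinguished point `x₀`: a bounded domain such that, for some
`C > 0`, every `x ∈ Ω` is joined to `x₀` by a curve `γ : [0, l] → Ω` parametrised by arclength
with `d(γ(t), ℝⁿ \ Ω) ≥ C t` for all `0 ≤ t ≤ l`. -/
def IsJohnDomain {n : ℕ} (Ω : Set (EuclideanSpace ℝ (Fin n))) (x₀ : EuclideanSpace ℝ (Fin n)) :
    Prop :=
  IsOpen Ω ∧ IsConnected Ω ∧ Bornology.IsBounded Ω ∧ x₀ ∈ Ω ∧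
    ∃ C : ℝ, 0 < C ∧ ∀ x ∈ Ω, ∃ (l : ℝ) (γ : ℝ → EuclideanSpace ℝ (Fin n)),
      0 ≤ l ∧ HasUnitSpeedOn γ (Icc 0 l) ∧ γ 0 = x ∧ γ l = x₀ ∧
      ∀ t ∈ Icc 0 l, γ t ∈ Ω ∧ C * t ≤ Metric.infDist (γ t) Ωᶜ

/-- The distance `ρ(x) = dist(x, ∂Ω)` to the boundary. -/
noncomputable def boundaryDist {n : ℕ} (Ω : Set (EuclideanSpace ℝ (Fin n)))
    (x : EuclideanSpace ℝ (Fin n)) : ℝ :=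
  Metric.infDist x (frontier Ω)

/-- The separation property of the domain `Ω` with distinguished point `x₀`. The last clause says
that `y` lies in a component of `Ω \ ∂B` that does not contain `x₀`. -/
def HasSeparationProperty {n : ℕ} (Ω : Set (EuclideanSpace ℝ (Fin n)))
    (x₀ : EuclideanSpace ℝ (Fin n)) : Prop :=
  IsOpen Ω ∧ IsConnected Ω ∧ x₀ ∈ Ω ∧
    ∃ C : ℝ, 0 < C ∧ ∀ x ∈ Ω, ∃ γ : ℝ → EuclideanSpace ℝ (Fin n),
      ContinuousOn γ (Icc 0 1) ∧ MapsTo γ (Icc 0 1) Ω ∧ γ 0 = x ∧ γ 1 = x₀ ∧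
      ∀ t ∈ Icc (0 : ℝ) 1,
        γ '' Icc 0 t ⊆ Metric.ball (γ t) (C * boundaryDist Ω (γ t)) ∨
        ∀ y ∈ γ '' Icc 0 t \ Metric.ball (γ t) (C * boundaryDist Ω (γ t)),
          y ∈ Ω \ frontier (Metric.ball (γ t) (C * boundaryDist Ω (γ t))) ∧
          x₀ ∉ connectedComponentIn
            (Ω \ frontier (Metric.ball (γ t) (C * boundaryDist Ω (γ t)))) y

/-- Smooth real functions with compact support in `Ω`. -/
def IsTestFunction {n : ℕ} (Ω : Set (EuclideanSpace ℝ (Fin n)))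
    (φ : EuclideanSpace ℝ (Fin n) → ℝ) : Prop :=
  ContDiff ℝ ∞ φ ∧ HasCompactSupport φ ∧ tsupport φ ⊆ Ω

/-- `u ∈ W^{1,p}(Ω)` with weak gradient `G`: both are in `L^p(Ω)`, and
`∫_Ω u ∂ᵢφ = - ∫_Ω Gᵢ φ` for all test functions `φ` and all `i`. -/
def MemSobolevWith {n : ℕ} (Ω : Set (EuclideanSpace ℝ (Fin n))) (p : ℝ)
    (u : EuclideanSpace ℝ (Fin n) → ℝ)
    (G : EuclideanSpace ℝ (Fin n) → EuclideanSpace ℝ (Fin n)) : Prop :=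
  MemLp u (ENNReal.ofReal p) (volume.restrict Ω) ∧
  MemLp G (ENNReal.ofReal p) (volume.restrict Ω) ∧
  ∀ φ : EuclideanSpace ℝ (Fin n) → ℝ, IsTestFunction Ω φ → ∀ i : Fin n,
    ∫ x in Ω, u x * gradient φ x i = - ∫ x in Ω, G x i * φ x

/-- `u ∈ W^{1,p}_0(Ω)`: `u` is in the closure of the test functions in the `W^{1,p}`-norm. -/
def MemSobolevZero {n : ℕ} (Ω : Set (EuclideanSpace ℝ (Fin n))) (p : ℝ)
    (u : EuclideanSpace ℝ (Fin n) → ℝ) : Prop :=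
  ∃ G : EuclideanSpace ℝ (Fin n) → EuclideanSpace ℝ (Fin n), MemSobolevWith Ω p u G ∧
    ∃ φ : ℕ → EuclideanSpace ℝ (Fin n) → ℝ, (∀ k, IsTestFunction Ω (φ k)) ∧
      Tendsto (fun k => eLpNorm (fun x => φ k x - u x) (ENNReal.ofReal p) (volume.restrict Ω))
        atTop (𝓝 0) ∧
      Tendsto (fun k => eLpNorm (fun x => gradient (φ k) x - G x) (ENNReal.ofReal p)
        (volume.restrict Ω)) atTop (𝓝 0)

/-- `f ∈ L^p_0(Ω)`: `f ∈ L^p(Ω)` has integral zero. -/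
def MemLpZero {n : ℕ} (Ω : Set (EuclideanSpace ℝ (Fin n))) (p : ℝ)
    (f : EuclideanSpace ℝ (Fin n) → ℝ) : Prop :=
  MemLp f (ENNReal.ofReal p) (volume.restrict Ω) ∧ ∫ x in Ω, f x = 0

/-- `v ∈ L^p(Ω)ⁿ` solves `div v = f`: `∫_Ω v · ∇g = - ∫_Ω f g` for all `g ∈ W^{1,q}(Ω)`,
where `q = p / (p - 1)` is the Hölder conjugate of `p`. -/
def IsDivSolution {n : ℕ} (Ω : Set (EuclideanSpace ℝ (Fin n))) (p : ℝ)
    (v : EuclideanSpace ℝ (Fin n) → EuclideanSpace ℝ (Fin n))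
    (f : EuclideanSpace ℝ (Fin n) → ℝ) : Prop :=
  MemLp v (ENNReal.ofReal p) (volume.restrict Ω) ∧
  ∀ (g : EuclideanSpace ℝ (Fin n) → ℝ)
    (Dg : EuclideanSpace ℝ (Fin n) → EuclideanSpace ℝ (Fin n)),
    MemSobolevWith Ω (p / (p - 1)) g Dg →
      ∫ x in Ω, inner ℝ (v x) (Dg x) = - ∫ x in Ω, f x * g x

/-! Points have zero `p`-capacity when `p ≤ n`, so puncturing a domain at finitely many points
barely affects Sobolev norms. It does affect `ρ`: if the punctures form a `t`-net of a disc in the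
hyperplane, then `ρ ≤ 2t` up to height `t` above that disc. A bump equal to a fixed constant at
heights between `t/2` and `t` then has Hardy quotient of `L^p`-norm at least of order `t⁻¹ ·
t^(1/p)`. This blows up as `t → 0` because `p > 1`, while the Sobolev norm stays as small as desired
(`exists_local_profile`, resting on `exists_cutoff_finite`).

Such nets are placed in disjoint balls shrinking to the origin, with the `k`-th bump of Sobolev norm
at most `2⁻ᵏ` and Hardy quotient at least `k`. The bumps are nonnegative and sum to some `u` in
`W^{1,p}_0` (`memSobolevZero_series`). The field `v = u e₀` with `f = ∂₀u` is the counterexample,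
and `f` has mean zero by testing against the constant 1.

The set `E`, made of the nets and the origin, lies in a hyperplane near the origin. A broken line
that first leaves the hyperplane and then turns to `e₀` is therefore a John curve
(`exists_johnCurve`), and John curves give the separation property by its first alternative. -/

/-! ### Zero capacity of finite sets -/

/-- Rescaling one bump by `s` gives a gradient of size `s` on a ball of radius `2/s`, hence energy
of order `s^(p-n)`. This is bounded for `s ≥ 1` because `p ≤ n`. -/
theorem exists_scaled_cutoffs {n : ℕ} {p : ℝ} (hp : 1 < p) (hpn : p ≤ (n : ℝ))
    (a : EuclideanSpace ℝ (Fin n)) :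
    ∃ (η : ℝ → EuclideanSpace ℝ (Fin n) → ℝ) (C : ENNReal), C ≠ ⊤ ∧ ∀ s : ℝ, 1 ≤ s →
      ContDiff ℝ ∞ (η s) ∧ (∀ x, 0 ≤ η s x ∧ η s x ≤ 1) ∧
      (∀ x, s * dist x a ≤ 1 → η s x = 0) ∧ (∀ x, 2 ≤ s * dist x a → η s x = 1) ∧
      (∀ x, fderiv ℝ (η s) x ≠ 0 → 1 ≤ s * dist x a ∧ s * dist x a ≤ 2) ∧
      ∫⁻ x, ‖fderiv ℝ (η s) x‖ₑ ^ p ≤ C := by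
  let b : ContDiffBump (0 : EuclideanSpace ℝ (Fin n)) := ⟨1, 2, one_pos, one_lt_two⟩
  obtain ⟨K, hK⟩ := ContDiff.lipschitzWith_of_hasCompactSupport (𝕂 := ℝ) b.hasCompactSupport
    (b.contDiff (n := 1)) one_ne_zero
  have hdist : ∀ (s : ℝ), 1 ≤ s → ∀ x, dist (s • (x - a)) 0 = s * dist x a := by
    intro s hs x
    rw [dist_zero_right, norm_smul, Real.norm_of_nonneg (by linarith), dist_eq_norm]
  let η : ℝ → EuclideanSpace ℝ (Fin n) → ℝ := fun s x => 1 - b (s • (x - a))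
  have hzero : ∀ s : ℝ, 1 ≤ s → ∀ x, s * dist x a ≤ 1 → η s x = 0 := by
    intro s hs x hx
    simp only [η]
    rw [b.one_of_mem_closedBall, sub_self]
    rwa [Metric.mem_closedBall, hdist s hs]
  have hone : ∀ s : ℝ, 1 ≤ s → ∀ x, 2 ≤ s * dist x a → η s x = 1 := by
    intro s hs x hx
    simp only [η]
    rw [b.zero_of_le_dist, sub_zero]
    rwa [hdist s hs]
  have hsupp : ∀ s : ℝ, 1 ≤ s → ∀ x, fderiv ℝ (η s) x ≠ 0 →
      1 ≤ s * dist x a ∧ s * dist x a ≤ 2 := by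
    intro s hs x hx
    have hc : Continuous fun y : EuclideanSpace ℝ (Fin n) => s * dist y a := by fun_prop
    constructor
    · by_contra! h
      refine hx ?_
      have : η s =ᶠ[𝓝 x] fun _ => 0 := by
        filter_upwards [hc.continuousAt.eventually_lt_const h] with y hy
        exact hzero s hs y hy.le
      rw [this.fderiv_eq]; simp
    · by_contra! h
      refine hx ?_
      have : η s =ᶠ[𝓝 x] fun _ => 1 := by
        filter_upwards [hc.continuousAt.eventually_const_lt h] with y hy
        exact hone s hs y hy.le
      rw [this.fderiv_eq]; simp
  refine ⟨η, (K : ENNReal) ^ p * (ENNReal.ofReal (2 ^ n) *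
    volume (Metric.ball (0 : EuclideanSpace ℝ (Fin n)) 1)), ?_, ?_⟩
  · refine ENNReal.mul_ne_top (ENNReal.rpow_ne_top_of_nonneg (by linarith) ENNReal.coe_ne_top) ?_
    exact ENNReal.mul_ne_top ENNReal.ofReal_ne_top measure_ball_lt_top.ne
  intro s hs
  have hs0 : 0 < s := by linarith
  refine ⟨?_, fun x => ⟨?_, ?_⟩, hzero s hs, hone s hs, hsupp s hs, ?_⟩
  · have h1 : ContDiff ℝ ∞ fun x : EuclideanSpace ℝ (Fin n) => s • (x - a) := by fun_prop
    exact contDiff_const.sub (b.contDiff.comp h1)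
  · simp only [η]; linarith [b.le_one (x := s • (x - a))]
  · simp only [η]; linarith [b.nonneg (x := s • (x - a))]
  · have hlip : LipschitzWith (K * s.toNNReal) (η s) := by
      refine LipschitzWith.of_dist_le_mul fun x y => ?_
      have h1 := hK.dist_le_mul (s • (x - a)) (s • (y - a))
      have h2 : dist (η s x) (η s y) = dist (b (s • (x - a))) (b (s • (y - a))) := by
        exact dist_sub_left _ _ _
      have h3 : dist (s • (x - a)) (s • (y - a)) = s * dist x y := by
        rw [dist_smul₀, dist_sub_right, Real.norm_of_nonneg hs0.le]
      rw [h2, NNReal.coe_mul, Real.coe_toNNReal _ hs0.le, mul_assoc, ← h3]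
      exact h1
    have hbound : ∀ x, ‖fderiv ℝ (η s) x‖ₑ ^ p ≤
        (Metric.closedBall a (2 / s)).indicator (fun _ => ((K * s.toNNReal : NNReal) : ENNReal) ^ p)
          x := by
      intro x
      by_cases hx : x ∈ Metric.closedBall a (2 / s)
      · rw [indicator_of_mem hx]
        refine ENNReal.rpow_le_rpow ?_ (by linarith)
        have := norm_fderiv_le_of_lipschitz ℝ hlip (x₀ := x)
        rw [enorm_eq_nnnorm]
        exact_mod_cast this
      · rw [indicator_of_notMem hx]
        have : fderiv ℝ (η s) x = 0 := by
          by_contra h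
          refine hx ?_
          rw [Metric.mem_closedBall, le_div_iff₀ hs0, mul_comm]
          exact (hsupp s hs x h).2
        rw [this, enorm_eq_nnnorm, nnnorm_zero, ENNReal.coe_zero, ENNReal.zero_rpow_of_pos (by linarith)]
    calc ∫⁻ x, ‖fderiv ℝ (η s) x‖ₑ ^ p
        ≤ ∫⁻ x, (Metric.closedBall a (2 / s)).indicator
            (fun _ => ((K * s.toNNReal : NNReal) : ENNReal) ^ p) x := lintegral_mono hbound
      _ = ((K * s.toNNReal : NNReal) : ENNReal) ^ p * volume (Metric.closedBall a (2 / s)) := by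
          rw [lintegral_indicator_const Metric.isClosed_closedBall.measurableSet]
      _ ≤ _ := by
          rw [Measure.addHaar_closedBall _ _ (by positivity), ENNReal.coe_mul,
            ENNReal.mul_rpow_of_nonneg _ _ (by linarith), mul_assoc]
          refine mul_le_mul_right ?_ _
          rw [← mul_assoc]
          refine mul_le_mul_left ?_ _
          rw [show ((s.toNNReal : NNReal) : ENNReal) = ENNReal.ofReal s from rfl,
            ENNReal.ofReal_rpow_of_pos hs0, ← ENNReal.ofReal_mul (by positivity)]
          refine ENNReal.ofReal_le_ofReal ?_
          rw [finrank_euclideanSpace_fin, div_pow, ← Real.rpow_natCast s n]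
          rw [mul_div_assoc', div_le_iff₀ (by positivity), mul_comm]
          gcongr

/-- For `p = n` a single scale does not suffice, so `N` cutoffs at scales `4^(m+i)` are averaged.
Their gradients live on disjoint annuli, so the energy is at most `N^(-p) · N · C = N^(1-p) C`,
which tends to zero since `p > 1`. -/
theorem exists_cutoff_point {n : ℕ} {p : ℝ} (hp : 1 < p) (hpn : p ≤ (n : ℝ))
    (a : EuclideanSpace ℝ (Fin n)) {ε : ENNReal} (hε : ε ≠ 0) {δ : ℝ} (hδ : 0 < δ) :
    ∃ χ : EuclideanSpace ℝ (Fin n) → ℝ, ContDiff ℝ ∞ χ ∧ (∀ x, 0 ≤ χ x ∧ χ x ≤ 1) ∧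
      (∀ᶠ x in 𝓝 a, χ x = 0) ∧ (∀ x, δ ≤ dist x a → χ x = 1) ∧
      eLpNorm (fderiv ℝ χ) (ENNReal.ofReal p) volume ≤ ε := by
  obtain ⟨η, C, hC, hη⟩ := exists_scaled_cutoffs hp hpn a
  have hp0 : 0 < p := by linarith
  -- the number of averaged scales
  obtain ⟨N, hN0, hN⟩ : ∃ N : ℕ, 0 < N ∧ ENNReal.ofReal ((N : ℝ) ^ (1 - p)) * C ≤ ε ^ p := by
    have h1 : Tendsto (fun N : ℕ => ENNReal.ofReal ((N : ℝ) ^ (1 - p)) * C) atTop (𝓝 (0 * C)) := by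
      refine ENNReal.Tendsto.mul_const ?_ (Or.inr hC)
      rw [← ENNReal.ofReal_zero]
      refine ENNReal.tendsto_ofReal ?_
      have := (tendsto_rpow_neg_atTop (show 0 < p - 1 by linarith)).comp tendsto_natCast_atTop_atTop
      simpa [Function.comp_def] using this
    rw [zero_mul] at h1
    have hεp : 0 < ε ^ p := by
      by_cases h : ε = ⊤
      · rw [h, ENNReal.top_rpow_of_pos hp0]; exact ENNReal.zero_lt_top
      · exact ENNReal.rpow_pos (pos_iff_ne_zero.2 hε) h
    obtain ⟨N, h2, h3⟩ := ((eventually_gt_atTop 0).and (h1.eventually_lt_const hεp)).exists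
    exact ⟨N, h2, h3.le⟩
  -- Makes every averaged cutoff already equal to 1 at distance `δ`.
  obtain ⟨m, hm⟩ : ∃ m : ℕ, 2 / δ < (4 : ℝ) ^ m := pow_unbounded_of_one_lt _ (by norm_num)
  have hs : ∀ i : ℕ, (1 : ℝ) ≤ 4 ^ (m + i) := fun i => one_le_pow₀ (by norm_num)
  have hNR : (0 : ℝ) < N := by exact_mod_cast hN0
  have hsm : ∀ i, ContDiff ℝ ∞ (η (4 ^ (m + i))) := fun i => (hη _ (hs i)).1
  let χ : EuclideanSpace ℝ (Fin n) → ℝ := fun x => (N : ℝ)⁻¹ * ∑ i ∈ Finset.range N, η (4 ^ (m + i)) x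
  refine ⟨χ, ?_, fun x => ⟨?_, ?_⟩, ?_, ?_, ?_⟩
  · exact contDiff_const.mul (ContDiff.sum fun i _ => hsm i)
  · exact mul_nonneg (by positivity) (Finset.sum_nonneg fun i _ => ((hη _ (hs i)).2.1 x).1)
  · have : ∑ i ∈ Finset.range N, η (4 ^ (m + i)) x ≤ ∑ i ∈ Finset.range N, 1 :=
      Finset.sum_le_sum fun i _ => ((hη _ (hs i)).2.1 x).2
    simp only [Finset.sum_const, Finset.card_range, nsmul_eq_mul, mul_one] at this
    simp only [χ]
    rw [inv_mul_le_iff₀ hNR]; linarith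
  · have hc : Continuous fun y : EuclideanSpace ℝ (Fin n) => (4 : ℝ) ^ (m + N) * dist y a := by
      fun_prop
    have h0 : (4 : ℝ) ^ (m + N) * dist a a < 1 := by simp
    filter_upwards [hc.continuousAt.eventually_lt_const h0] with x hx
    simp only [χ]
    rw [Finset.sum_eq_zero, mul_zero]
    intro i hi
    refine (hη _ (hs i)).2.2.1 x (le_trans ?_ hx.le)
    gcongr
    · norm_num
    · exact (Finset.mem_range.1 hi).le
  · intro x hx
    have : ∀ i ∈ Finset.range N, η (4 ^ (m + i)) x = 1 := by
      intro i _
      refine (hη _ (hs i)).2.2.2.1 x ?_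
      have h1 : (4 : ℝ) ^ m ≤ 4 ^ (m + i) := pow_le_pow_right₀ (by norm_num) (by omega)
      rw [div_lt_iff₀ hδ] at hm
      calc (2 : ℝ) ≤ 4 ^ m * δ := hm.le
        _ ≤ _ := by gcongr
    simp only [χ]
    rw [Finset.sum_congr rfl this]
    simp [hNR.ne']
  · have hfd : ∀ x, fderiv ℝ χ x = (N : ℝ)⁻¹ • ∑ i ∈ Finset.range N, fderiv ℝ (η (4 ^ (m + i))) x := by
      intro x
      have hd : ∀ i ∈ Finset.range N, DifferentiableAt ℝ (η (4 ^ (m + i))) x := fun i _ =>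
        ((hsm i).differentiable (by simp)).differentiableAt
      rw [← fderiv_fun_sum hd]
      exact fderiv_const_mul (DifferentiableAt.fun_sum hd) _
    have hpt : ∀ x, ‖fderiv ℝ χ x‖ₑ ^ p ≤ ENNReal.ofReal ((N : ℝ)⁻¹ ^ p) *
        ∑ i ∈ Finset.range N, ‖fderiv ℝ (η (4 ^ (m + i))) x‖ₑ ^ p := by
      intro x
      rw [hfd, enorm_smul, ENNReal.mul_rpow_of_nonneg _ _ hp0.le,
        Real.enorm_of_nonneg (by positivity), ENNReal.ofReal_rpow_of_nonneg (by positivity) hp0.le]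
      gcongr
      -- At each point at most one gradient is nonzero, so the `p`-th power passes through the sum
      -- without loss.
      by_cases h : ∃ j ∈ Finset.range N, fderiv ℝ (η (4 ^ (m + j))) x ≠ 0
      · obtain ⟨j, hj, hjx⟩ := h
        have hother : ∀ i ∈ Finset.range N, i ≠ j → fderiv ℝ (η (4 ^ (m + i))) x = 0 := by
          intro i _ hij
          by_contra hix
          have h1 := (hη _ (hs i)).2.2.2.2.1 x hix
          have h2 := (hη _ (hs j)).2.2.2.2.1 x hjx
          have key : ∀ i j : ℕ, i < j → (1 : ℝ) ≤ 4 ^ (m + i) * dist x a →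
              4 ^ (m + j) * dist x a ≤ 2 → False := by
            intro i j hij h1 h2
            have h3 : (4 : ℝ) * 4 ^ (m + i) ≤ 4 ^ (m + j) := by
              rw [← pow_succ']
              exact pow_le_pow_right₀ (by norm_num) (by omega)
            nlinarith [dist_nonneg (x := x) (y := a)]
          rcases lt_or_gt_of_ne hij with h | h
          · exact key i j h h1.1 h2.2
          · exact key j i h h2.1 h1.2
        rw [Finset.sum_eq_single_of_mem j hj hother]
        exact Finset.single_le_sum (f := fun i => ‖fderiv ℝ (η (4 ^ (m + i))) x‖ₑ ^ p)
          (fun _ _ => zero_le) hj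
      · push Not at h
        rw [Finset.sum_eq_zero h, enorm_eq_nnnorm, nnnorm_zero, ENNReal.coe_zero,
          ENNReal.zero_rpow_of_pos hp0]
        exact zero_le
    rw [eLpNorm_eq_lintegral_rpow_enorm_toReal (by simpa using hp0) ENNReal.ofReal_ne_top,
      ENNReal.toReal_ofReal hp0.le, one_div, ENNReal.rpow_inv_le_iff hp0]
    refine le_trans ?_ hN
    calc ∫⁻ x, ‖fderiv ℝ χ x‖ₑ ^ p
        ≤ ∫⁻ x, ENNReal.ofReal ((N : ℝ)⁻¹ ^ p) *
          ∑ i ∈ Finset.range N, ‖fderiv ℝ (η (4 ^ (m + i))) x‖ₑ ^ p := lintegral_mono hpt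
      _ = ENNReal.ofReal ((N : ℝ)⁻¹ ^ p) *
          ∑ i ∈ Finset.range N, ∫⁻ x, ‖fderiv ℝ (η (4 ^ (m + i))) x‖ₑ ^ p := by
          have hmeas : ∀ i, Measurable fun x => ‖fderiv ℝ (η (4 ^ (m + i))) x‖ₑ ^ p := fun i =>
            (((hsm i).continuous_fderiv (by simp)).enorm.measurable).pow_const _
          rw [lintegral_const_mul _ (Finset.measurable_fun_sum _ fun i _ => hmeas i),
            lintegral_finsetSum _ fun i _ => hmeas i]
      _ ≤ ENNReal.ofReal ((N : ℝ)⁻¹ ^ p) * ∑ i ∈ Finset.range N, C := by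
          gcongr with i hi
          exact (hη _ (hs i)).2.2.2.2.2
      _ = ENNReal.ofReal ((N : ℝ) ^ (1 - p)) * C := by
          rw [Finset.sum_const, Finset.card_range, nsmul_eq_mul, ← mul_assoc,
            ← ENNReal.ofReal_natCast, ← ENNReal.ofReal_mul (by positivity)]
          congr 2
          rw [Real.inv_rpow hNR.le, Real.rpow_sub hNR, Real.rpow_one]
          field_simp

/-- Multiply the one-point cutoffs: with factors in `[0, 1]`, the gradient of a product is bounded
by the sum of the gradients. The bound `ε` does not depend on the number of points. -/
theorem exists_cutoff_finite {n : ℕ} {p : ℝ} (hp : 1 < p) (hpn : p ≤ (n : ℝ))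
    {F : Set (EuclideanSpace ℝ (Fin n))} (hF : F.Finite) {δ : ℝ} (hδ : 0 < δ) :
    ∀ {ε : ENNReal}, ε ≠ 0 →
    ∃ χ : EuclideanSpace ℝ (Fin n) → ℝ, ContDiff ℝ ∞ χ ∧ (∀ x, 0 ≤ χ x ∧ χ x ≤ 1) ∧
      (∀ a ∈ F, ∀ᶠ x in 𝓝 a, χ x = 0) ∧ (∀ x, (∀ a ∈ F, δ ≤ dist x a) → χ x = 1) ∧
      eLpNorm (fderiv ℝ χ) (ENNReal.ofReal p) volume ≤ ε := by
  induction F, hF using Set.Finite.induction_on with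
  | empty =>
    intro ε _
    refine ⟨fun _ => 1, contDiff_const, by simp, by simp, by simp, ?_⟩
    rw [← eLpNorm_norm]
    simp
  | @insert a F ha hF ih =>
    intro ε hε
    have hε2 : ε / 2 ≠ 0 := by simpa using hε
    obtain ⟨χ, h1, h2, h3, h4, h5⟩ := ih hε2
    obtain ⟨θ, g1, g2, g3, g4, g5⟩ := exists_cutoff_point hp hpn a hε2 hδ
    refine ⟨fun x => χ x * θ x, h1.mul g1, fun x => ⟨mul_nonneg (h2 x).1 (g2 x).1,
      mul_le_one₀ (h2 x).2 (g2 x).1 (g2 x).2⟩, ?_, ?_, ?_⟩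
    · intro b hb
      rcases hb with rfl | hb
      · filter_upwards [g3] with x hx
        simp [hx]
      · filter_upwards [h3 b hb] with x hx
        simp [hx]
    · intro x hx
      change χ x * θ x = 1
      rw [h4 x fun b hb => hx b (mem_insert_of_mem _ hb), g4 x (hx a (mem_insert _ _)), mul_one]
    · have hcχ := h1.continuous_fderiv (by simp)
      have hcθ := g1.continuous_fderiv (by simp)
      calc eLpNorm (fderiv ℝ fun x => χ x * θ x) (ENNReal.ofReal p) volume
          ≤ eLpNorm (fun x => ‖fderiv ℝ χ x‖ + ‖fderiv ℝ θ x‖) (ENNReal.ofReal p) volume := by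
            refine eLpNorm_mono_real fun x => ?_
            rw [fderiv_fun_mul (h1.differentiable (by simp)).differentiableAt
              (g1.differentiable (by simp)).differentiableAt]
            refine (norm_add_le _ _).trans ?_
            rw [norm_smul, norm_smul, Real.norm_of_nonneg (h2 x).1, Real.norm_of_nonneg (g2 x).1]
            nlinarith [norm_nonneg (fderiv ℝ χ x), norm_nonneg (fderiv ℝ θ x), (h2 x).2, (g2 x).2]
        _ ≤ eLpNorm (fun x => ‖fderiv ℝ χ x‖) (ENNReal.ofReal p) volume +
            eLpNorm (fun x => ‖fderiv ℝ θ x‖) (ENNReal.ofReal p) volume :=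
            eLpNorm_add_le hcχ.norm.aestronglyMeasurable hcθ.norm.aestronglyMeasurable
              (by simpa using hp.le)
        _ ≤ ε / 2 + ε / 2 := by rw [eLpNorm_norm, eLpNorm_norm]; exact add_le_add h5 g5
        _ = ε := ENNReal.add_halves ε

/-! ### One bump with small Sobolev norm and large Hardy quotient -/

theorem norm_gradient_eq {n : ℕ} (f : EuclideanSpace ℝ (Fin n) → ℝ)
    (x : EuclideanSpace ℝ (Fin n)) : ‖gradient f x‖ = ‖fderiv ℝ f x‖ := by
  rw [gradient, LinearIsometryEquiv.norm_map]

theorem eLpNorm_gradient_eq {n : ℕ} (f : EuclideanSpace ℝ (Fin n) → ℝ) (p : ENNReal)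
    (μ : Measure (EuclideanSpace ℝ (Fin n))) :
    eLpNorm (gradient f) p μ = eLpNorm (fderiv ℝ f) p μ :=
  eLpNorm_congr_norm_ae (ae_of_all _ (norm_gradient_eq f))

theorem exists_box_subset_ball {n : ℕ} (z : EuclideanSpace ℝ (Fin n)) {r : ℝ} (hr : 0 < r) :
    ∃ s : ℝ, 0 < s ∧ ∀ x : EuclideanSpace ℝ (Fin n), (∀ i, |x i - z i| < s) → dist x z < r := by
  obtain ⟨s, hs, h⟩ := Metric.continuousAt_iff.1
    ((PiLp.continuous_toLp 2 fun _ : Fin n => ℝ).continuousAt (x := z.ofLp)) r hr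
  refine ⟨s, hs, fun x hx => ?_⟩
  exact @h x.ofLp ((dist_pi_lt_iff hs).2 hx)

/-- The part at height between `t / 2` and `t` over the box of half-side `s` around `z` in the
hyperplane where the last coordinate vanishes. -/
def slabBox {m : ℕ} (z : EuclideanSpace ℝ (Fin (m + 1))) (s t : ℝ) :
    Set (EuclideanSpace ℝ (Fin (m + 1))) :=
  {x | (∀ i : Fin m, |x i.castSucc - z i.castSucc| < s) ∧ t / 2 < x (Fin.last m) ∧
    x (Fin.last m) < t}

theorem slabBox_eq {m : ℕ} (z : EuclideanSpace ℝ (Fin (m + 1))) (s t : ℝ) :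
    slabBox z s t = WithLp.ofLp ⁻¹' (Set.univ.pi fun i =>
      Ioo ((Fin.lastCases (t / 2) (fun i : Fin m => z i.castSucc - s) i : ℝ))
        (Fin.lastCases t (fun i : Fin m => z i.castSucc + s) i : ℝ)) := by
  ext x
  simp only [slabBox, mem_ofPred_eq, mem_preimage, mem_univ_pi, mem_Ioo, Fin.forall_fin_succ',
    Fin.lastCases_castSucc, Fin.lastCases_last, abs_sub_lt_iff]
  refine and_congr (forall_congr' fun i => ?_) Iff.rfl
  constructor <;> rintro ⟨h1, h2⟩ <;> constructor <;> linarith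

theorem measurableSet_slabBox {m : ℕ} (z : EuclideanSpace ℝ (Fin (m + 1))) (s t : ℝ) :
    MeasurableSet (slabBox z s t) := by
  rw [slabBox_eq]
  exact (PiLp.volume_preserving_ofLp _).measurable
    (MeasurableSet.univ_pi fun _ => measurableSet_Ioo)

theorem volume_slabBox {m : ℕ} (z : EuclideanSpace ℝ (Fin (m + 1))) {s t : ℝ} (hs : 0 < s) :
    volume (slabBox z s t) = ENNReal.ofReal ((2 * s) ^ m * (t / 2)) := by
  rw [slabBox_eq, (PiLp.volume_preserving_ofLp _).measure_preimage
    (MeasurableSet.univ_pi fun _ => measurableSet_Ioo).nullMeasurableSet, Real.volume_pi_Ioo,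
    Fin.prod_univ_castSucc]
  simp only [Fin.lastCases_castSucc, Fin.lastCases_last]
  rw [ENNReal.ofReal_mul (by positivity), ENNReal.ofReal_pow (by positivity)]
  congr 1
  · rw [Finset.prod_congr rfl fun i _ => by
      rw [show z i.castSucc + s - (z i.castSucc - s) = 2 * s by ring]]
    simp
  · congr 1; ring

/-- The right-hand side is a constant times `t^(1/p - 1)`, a negative power. Here `V * (t / 2)`
stands for the volume of a slab and `2 * t` for the bound on `ρ` there. -/
theorem exists_small_slab {p : ℝ} (hp : 1 < p) {c V s : ℝ} (hc : 0 < c) (hV : 0 < V) (hs : 0 < s)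
    (M : ℝ) : ∃ t : ℝ, 0 < t ∧ t < s ∧ M ≤ c / (2 * t) * (V * (t / 2)) ^ (1 / p) := by
  have h1 : Tendsto (fun t : ℝ => c / 2 * (V / 2) ^ (1 / p) * t ^ (1 / p - 1)) (𝓝[>] 0) atTop := by
    refine Tendsto.const_mul_atTop (by positivity) (tendsto_rpow_neg_nhdsGT_zero ?_)
    rw [sub_neg, div_lt_one (by linarith)]; exact hp
  obtain ⟨t, h2, h3⟩ := ((h1.eventually_ge_atTop M).and (Ioo_mem_nhdsGT hs)).exists
  refine ⟨t, h3.1, h3.2, h2.trans_eq ?_⟩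
  have ht := h3.1
  rw [Real.rpow_sub ht, Real.rpow_one, show V * (t / 2) = V / 2 * t by ring,
    Real.mul_rpow (by positivity) ht.le]
  field_simp

/-- The bump is `ψ = c w χ`, with `w` a fixed bump and `χ` vanishing near the net `F`. The order of
choices matters: `c` is fixed by `ε` alone, then `t` by `c` and `M`, and only then `F` and `χ`. -/
theorem exists_local_profile {m : ℕ} {p : ℝ} (hp : 1 < p) (hpn : p ≤ ((m + 1 : ℕ) : ℝ))
    (z : EuclideanSpace ℝ (Fin (m + 1))) (hz : z (Fin.last m) = 0) {r : ℝ} (hr : 0 < r)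
    {ε : ENNReal} (hε : ε ≠ 0) (M : ℝ) :
    ∃ F : Set (EuclideanSpace ℝ (Fin (m + 1))), F.Finite ∧
      (∀ a ∈ F, a ∈ Metric.ball z r ∧ a (Fin.last m) = 0) ∧
      ∃ ψ : EuclideanSpace ℝ (Fin (m + 1)) → ℝ, ContDiff ℝ ∞ ψ ∧ (∀ x, 0 ≤ ψ x) ∧
        HasCompactSupport ψ ∧ tsupport ψ ⊆ Metric.ball z r \ F ∧
        eLpNorm ψ (ENNReal.ofReal p) volume ≤ ε ∧
        eLpNorm (gradient ψ) (ENNReal.ofReal p) volume ≤ ε ∧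
        ∀ ρ : EuclideanSpace ℝ (Fin (m + 1)) → ℝ, (∀ x ∈ tsupport ψ, 0 < ρ x) →
          (∀ x, ∀ a ∈ F, ρ x ≤ dist x a) →
          ENNReal.ofReal M ≤ eLpNorm (fun x => (ρ x)⁻¹ * ψ x) (ENNReal.ofReal p) volume := by
  have hp0 : 0 < p := by linarith
  have hp1 : 1 ≤ ENNReal.ofReal p := by simpa using hp.le
  let w : ContDiffBump z := ⟨r / 2, 3 * r / 4, by positivity, by linarith⟩
  have hw : ContDiff ℝ ∞ w := w.contDiff
  have hwd : Continuous (fderiv ℝ w) := hw.continuous_fderiv (by simp)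
  have hA := (hw.continuous.memLp_of_hasCompactSupport (p := ENNReal.ofReal p) (μ := volume)
    w.hasCompactSupport).eLpNorm_ne_top
  have hB := (hwd.memLp_of_hasCompactSupport (p := ENNReal.ofReal p) (μ := volume)
    (w.hasCompactSupport.fderiv ℝ)).eLpNorm_ne_top
  -- The summand 1 reserves room for the gradient norm of `χ`, which will be at most 1 whatever the
  -- net is.
  obtain ⟨c', hc', hcε⟩ := ENNReal.exists_nnreal_pos_mul_lt
    (ENNReal.add_ne_top.2 ⟨hA, ENNReal.add_ne_top.2 ⟨hB, ENNReal.one_ne_top⟩⟩) hε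
  obtain ⟨c, hc, hcc⟩ : ∃ c : ℝ, 0 < c ∧ ‖c‖ₑ = c' := ⟨c', hc', by simp⟩
  obtain ⟨s, hs, hbox⟩ := exists_box_subset_ball z (half_pos hr)
  obtain ⟨t, ht, hts, htM⟩ := exists_small_slab hp hc (V := (2 * s) ^ m) (by positivity) hs M
  let K : Set (EuclideanSpace ℝ (Fin (m + 1))) := Metric.closedBall z (r / 2) ∩ {x | x (Fin.last m) = 0}
  have hK : IsCompact K := (isCompact_closedBall _ _).inter_right
    (isClosed_eq (by fun_prop) continuous_const)
  obtain ⟨F, hFK, hF, hFcov⟩ := hK.finite_cover_balls ht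
  -- Radius `t / 2` ensures `χ = 1` on the slab, whose points have height above `t / 2` over the
  -- hyperplane containing `F`.
  obtain ⟨χ, g1, g2, g3, g4, g5⟩ := exists_cutoff_finite hp hpn hF (half_pos ht) one_ne_zero
  have hgd : Continuous (fderiv ℝ χ) := g1.continuous_fderiv (by simp)
  let ψ : EuclideanSpace ℝ (Fin (m + 1)) → ℝ := c • fun x => w x * χ x
  have hψ : ∀ x, ψ x = c * (w x * χ x) := fun x => rfl
  have hwχ : ContDiff ℝ ∞ fun x => w x * χ x := hw.mul g1
  have hsuppw : tsupport ψ ⊆ Metric.closedBall z (3 * r / 4) := by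
    rw [← w.tsupport_eq]
    refine closure_mono fun x hx hx0 => hx ?_
    simp [hψ, hx0]
  refine ⟨F, hF, fun a ha => ?_, ψ, hwχ.const_smul c, fun x => ?_, ?_, fun x hx => ⟨?_, ?_⟩, ?_, ?_, ?_⟩
  · exact ⟨Metric.closedBall_subset_ball (by linarith) (hFK ha).1, (hFK ha).2⟩
  · exact mul_nonneg hc.le (mul_nonneg w.nonneg (g2 x).1)
  · exact HasCompactSupport.of_support_subset_isCompact (isCompact_closedBall z (3 * r / 4))
      (subset_closure.trans hsuppw)
  · exact Metric.closedBall_subset_ball (by linarith) (hsuppw hx)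
  · intro hxF
    refine (notMem_tsupport_iff_eventuallyEq.2 ?_) hx
    filter_upwards [g3 x hxF] with y hy
    simp [hψ, hy]
  · rw [eLpNorm_const_smul, hcc]
    refine le_trans (mul_le_mul_right ?_ _) hcε.le
    refine le_trans (eLpNorm_mono fun x => ?_) le_self_add
    rw [norm_mul, Real.norm_of_nonneg (g2 x).1]
    exact mul_le_of_le_one_right (norm_nonneg _) (g2 x).2
  · have hfd : gradient ψ = c • gradient fun x => w x * χ x := by
      ext1 x
      rw [Pi.smul_apply, gradient, gradient,
        show fderiv ℝ ψ x = c • fderiv ℝ (fun x => w x * χ x) x from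
          fderiv_const_smul (hwχ.differentiable (by simp)).differentiableAt c]
      simp
    rw [hfd, eLpNorm_const_smul, hcc, eLpNorm_gradient_eq]
    refine le_trans (mul_le_mul_right ?_ _) hcε.le
    refine le_trans ?_ le_add_self
    calc eLpNorm (fderiv ℝ fun x => w x * χ x) (ENNReal.ofReal p) volume
        ≤ eLpNorm (fun x => ‖fderiv ℝ w x‖ + ‖fderiv ℝ χ x‖) (ENNReal.ofReal p) volume := by
          refine eLpNorm_mono_real fun x => ?_
          rw [fderiv_fun_mul (hw.differentiable (by simp)).differentiableAt
            (g1.differentiable (by simp)).differentiableAt]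
          refine (norm_add_le _ _).trans ?_
          rw [norm_smul, norm_smul, Real.norm_of_nonneg w.nonneg, Real.norm_of_nonneg (g2 x).1]
          nlinarith [norm_nonneg (fderiv ℝ χ x), norm_nonneg (fderiv ℝ w x), (g2 x).2,
            w.le_one (x := x)]
      _ ≤ eLpNorm (fun x => ‖fderiv ℝ w x‖) (ENNReal.ofReal p) volume +
          eLpNorm (fun x => ‖fderiv ℝ χ x‖) (ENNReal.ofReal p) volume :=
          eLpNorm_add_le hwd.norm.aestronglyMeasurable hgd.norm.aestronglyMeasurable hp1
      _ ≤ _ := by rw [eLpNorm_norm, eLpNorm_norm]; exact add_le_add le_rfl g5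
  · intro ρ hρ0 hρ
    have hT : ∀ x ∈ slabBox z s t, c / (2 * t) ≤ (ρ x)⁻¹ * ψ x := by
      rintro x ⟨hx1, hx2, hx3⟩
      have hxz : dist x z < r / 2 := by
        refine hbox x fun i => ?_
        refine Fin.lastCases ?_ hx1 i
        rw [hz, sub_zero, abs_of_pos (by linarith)]
        linarith
      have hψx : ψ x = c := by
        rw [hψ, w.one_of_mem_closedBall (Metric.mem_closedBall.2 hxz.le), g4, mul_one, mul_one]
        intro a ha
        have h1 := PiLp.norm_apply_le (x - a) (Fin.last m)
        rw [PiLp.sub_apply, (hFK ha).2, sub_zero, Real.norm_of_nonneg (by linarith),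
          ← dist_eq_norm] at h1
        linarith
      -- The projection of `x` to the hyperplane: it is within `t` of `x` and of some net point,
      -- whence `ρ x ≤ 2 * t`.
      let x' : EuclideanSpace ℝ (Fin (m + 1)) :=
        x - EuclideanSpace.single (Fin.last m) (x (Fin.last m))
      have hx' : x' ∈ K := by
        refine ⟨Metric.mem_closedBall.2 (hbox x' fun i => ?_).le, ?_⟩
        · refine Fin.lastCases ?_ (fun i => ?_) i
          · simp [x', hz, hs]
          · have : i.castSucc ≠ Fin.last m := (Fin.castSucc_lt_last i).ne
            simpa [x', this] using hx1 i
        · simp [x']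
      obtain ⟨a, ha, hxa⟩ := mem_iUnion₂.1 (hFcov hx')
      have hxx' : dist x x' ≤ t := by
        simp only [x', dist_eq_norm, sub_sub_cancel]
        rw [PiLp.norm_single, Real.norm_of_nonneg (by linarith)]
        exact hx3.le
      have h2 : ρ x ≤ 2 * t := by
        have := dist_triangle x x' a
        have h3 := hρ x a ha
        rw [Metric.mem_ball] at hxa
        linarith
      have h0 : 0 < ρ x := hρ0 x (subset_closure (by rw [Function.mem_support, hψx]; exact hc.ne'))
      rw [hψx, inv_mul_eq_div]
      gcongr
    calc ENNReal.ofReal M ≤ ENNReal.ofReal (c / (2 * t) * ((2 * s) ^ m * (t / 2)) ^ (1 / p)) :=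
          ENNReal.ofReal_le_ofReal htM
      _ = eLpNorm ((slabBox z s t).indicator fun _ => c / (2 * t)) (ENNReal.ofReal p) volume := by
          rw [eLpNorm_indicator_const (measurableSet_slabBox z s t) (by simpa using hp0)
            ENNReal.ofReal_ne_top, volume_slabBox z hs, ENNReal.toReal_ofReal hp0.le,
            Real.enorm_of_nonneg (by positivity), ENNReal.ofReal_rpow_of_nonneg (by positivity)
            (by positivity), ← ENNReal.ofReal_mul (by positivity)]
      _ ≤ _ := by
          refine eLpNorm_mono fun x => ?_
          by_cases hx : x ∈ slabBox z s t
          · rw [indicator_of_mem hx, Real.norm_of_nonneg (by positivity)]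
            exact (hT x hx).trans (Real.le_norm_self _)
          · rw [indicator_of_notMem hx, norm_zero]
            exact norm_nonneg _

/-! ### Series and limits in `L^p` -/

/-- Minkowski for the partial sums, then Fatou for the pointwise limit. -/
theorem eLpNorm_series_le {α F : Type*} [MeasurableSpace α] [NormedAddCommGroup F]
    {μ : Measure α} {p : ENNReal} (hp : 1 ≤ p) {h : ℕ → α → F} {S : α → F} {c : ℕ → ENNReal}
    (hm : ∀ k, AEStronglyMeasurable (h k) μ) (hc : ∀ k, eLpNorm (h k) p μ ≤ c k)
    (hS : ∀ x, HasSum (fun k => h k x) (S x)) : eLpNorm S p μ ≤ ∑' k, c k := by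
  refine (Lp.eLpNorm_lim_le_liminf_eLpNorm (f := fun j x => ∑ k ∈ Finset.range j, h k x)
    (fun j => Finset.aestronglyMeasurable_fun_sum _ fun k _ => hm k) S
    (ae_of_all _ fun x => (hS x).tendsto_sum_nat)).trans ?_
  refine liminf_le_of_frequently_le' (Frequently.of_forall fun j => ?_)
  have h1 : (fun x => ∑ k ∈ Finset.range j, h k x) = ∑ k ∈ Finset.range j, h k := by
    ext x; simp
  rw [h1]
  calc eLpNorm (∑ k ∈ Finset.range j, h k) p μ ≤ ∑ k ∈ Finset.range j, eLpNorm (h k) p μ :=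
        eLpNorm_sum_le (fun k _ => hm k) hp
    _ ≤ ∑ k ∈ Finset.range j, c k := Finset.sum_le_sum fun k _ => hc k
    _ ≤ ∑' k, c k := ENNReal.sum_le_tsum _

theorem memLp_series {α F : Type*} [MeasurableSpace α] [NormedAddCommGroup F]
    {μ : Measure α} {p : ENNReal} (hp : 1 ≤ p) {h : ℕ → α → F} {S : α → F} {c : ℕ → ENNReal}
    (hm : ∀ k, AEStronglyMeasurable (h k) μ) (hc : ∀ k, eLpNorm (h k) p μ ≤ c k)
    (hcs : ∑' k, c k ≠ ⊤) (hS : ∀ x, HasSum (fun k => h k x) (S x)) : MemLp S p μ :=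
  ⟨aestronglyMeasurable_of_tendsto_ae atTop
    (f := fun j x => ∑ k ∈ Finset.range j, h k x)
    (fun _ => Finset.aestronglyMeasurable_fun_sum _ fun k _ => hm k)
    (ae_of_all _ fun x => (hS x).tendsto_sum_nat),
    (eLpNorm_series_le hp hm hc hS).trans_lt hcs.lt_top⟩

theorem tendsto_eLpNorm_series {α F : Type*} [MeasurableSpace α] [NormedAddCommGroup F]
    {μ : Measure α} {p : ENNReal} (hp : 1 ≤ p) {h : ℕ → α → F} {S : α → F} {c : ℕ → ENNReal}
    (hm : ∀ k, AEStronglyMeasurable (h k) μ) (hc : ∀ k, eLpNorm (h k) p μ ≤ c k)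
    (hcs : ∑' k, c k ≠ ⊤) (hS : ∀ x, HasSum (fun k => h k x) (S x)) :
    Tendsto (fun K => eLpNorm (fun x => ∑ k ∈ Finset.range K, h k x - S x) p μ) atTop (𝓝 0) := by
  refine tendsto_of_tendsto_of_tendsto_of_le_of_le tendsto_const_nhds
    (ENNReal.tendsto_sum_nat_add c hcs) (fun _ => zero_le) fun K => ?_
  have h1 : (fun x => ∑ k ∈ Finset.range K, h k x - S x) =
      -fun x => S x - ∑ k ∈ Finset.range K, h k x := by
    ext x; simp
  simp only []
  rw [h1, eLpNorm_neg]
  refine eLpNorm_series_le hp (fun k => hm (k + K)) (fun k => hc (k + K)) fun x => ?_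
  exact (hasSum_nat_add_iff' K).2 (hS x)

theorem tendsto_integral_mul_of_eLpNorm {α : Type*} [MeasurableSpace α] {μ : Measure α}
    {p q : ENNReal} [p.HolderTriple q 1] {F : ℕ → α → ℝ} {f g : α → ℝ}
    (hF : ∀ k, MemLp (F k) p μ) (hf : MemLp f p μ) (hg : MemLp g q μ)
    (h : Tendsto (fun k => eLpNorm (fun x => F k x - f x) p μ) atTop (𝓝 0)) :
    Tendsto (fun k => ∫ x, F k x * g x ∂μ) atTop (𝓝 (∫ x, f x * g x ∂μ)) := by
  refine tendsto_integral_of_L1' _ (hf.integrable_mul hg).aestronglyMeasurable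
    (Eventually.of_forall fun k => (hF k).integrable_mul hg) ?_
  have h1 : Tendsto (fun k => eLpNorm (fun x => F k x - f x) p μ * eLpNorm g q μ) atTop
      (𝓝 0) := by
    simpa using ENNReal.Tendsto.mul_const h (Or.inr hg.eLpNorm_ne_top)
  refine tendsto_of_tendsto_of_tendsto_of_le_of_le tendsto_const_nhds h1 (fun _ => zero_le)
    fun k => ?_
  have h2 := eLpNorm_smul_le_mul_eLpNorm (p := p) (q := q) (r := 1)
    hg.aestronglyMeasurable ((hF k).sub hf).aestronglyMeasurable
  refine le_of_eq_of_le ?_ h2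
  congr 1
  ext x
  simp [sub_mul]

/-! ### Weak gradients and integration by parts -/

theorem gradient_apply {n : ℕ} (f : EuclideanSpace ℝ (Fin n) → ℝ) (x : EuclideanSpace ℝ (Fin n))
    (i : Fin n) : gradient f x i = fderiv ℝ f x (EuclideanSpace.single i 1) := by
  rw [← inner_gradient_left, EuclideanSpace.inner_single_right]
  simp

theorem continuous_gradient {n : ℕ} {f : EuclideanSpace ℝ (Fin n) → ℝ} (hf : ContDiff ℝ ∞ f) :
    Continuous (gradient f) :=
  (InnerProductSpace.toDual ℝ _).symm.continuous.comp (hf.continuous_fderiv (by simp))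

theorem gradient_eq_zero_of_notMem_tsupport {n : ℕ} {f : EuclideanSpace ℝ (Fin n) → ℝ}
    {x : EuclideanSpace ℝ (Fin n)} (hx : x ∉ tsupport f) : gradient f x = 0 := by
  rw [gradient, image_eq_zero_of_notMem_tsupport fun h => hx (tsupport_fderiv_subset ℝ h),
    map_zero]

theorem hasCompactSupport_gradient {n : ℕ} {f : EuclideanSpace ℝ (Fin n) → ℝ}
    (hf : HasCompactSupport f) : HasCompactSupport (gradient f) :=
  HasCompactSupport.intro hf fun _ hx => gradient_eq_zero_of_notMem_tsupport hx

theorem integral_mul_gradient_eq_neg {n : ℕ} {Ω : Set (EuclideanSpace ℝ (Fin n))}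
    {φ g : EuclideanSpace ℝ (Fin n) → ℝ} (hφ : IsTestFunction Ω φ) (hg : ContDiff ℝ ∞ g)
    (i : Fin n) : ∫ x in Ω, g x * gradient φ x i = -∫ x in Ω, gradient g x i * φ x := by
  obtain ⟨h1, h2, h3⟩ := hφ
  have hcφ : Continuous fun x => fderiv ℝ φ x (EuclideanSpace.single i 1) :=
    (h1.continuous_fderiv (by simp)).clm_apply continuous_const
  have hcg : Continuous fun x => fderiv ℝ g x (EuclideanSpace.single i 1) :=
    (hg.continuous_fderiv (by simp)).clm_apply continuous_const
  have h2' : HasCompactSupport fun x => fderiv ℝ φ x (EuclideanSpace.single i 1) :=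
    h2.fderiv_apply ℝ _
  have h0 : ∀ x, x ∉ Ω → φ x = 0 := fun x hx =>
    image_eq_zero_of_notMem_tsupport fun h => hx (h3 h)
  have h0' : ∀ x, x ∉ Ω → gradient φ x = 0 := fun x hx =>
    gradient_eq_zero_of_notMem_tsupport fun h => hx (h3 h)
  rw [setIntegral_eq_integral_of_forall_compl_eq_zero fun x hx => by simp [h0' x hx],
    setIntegral_eq_integral_of_forall_compl_eq_zero fun x hx => by simp [h0 x hx]]
  simp only [gradient_apply]
  refine integral_mul_fderiv_eq_neg_fderiv_mul_of_integrable ?_ ?_ ?_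
    (fun x _ => (hg.differentiable (by simp)).differentiableAt)
    (fun x _ => (h1.differentiable (by simp)).differentiableAt)
  · exact (hcg.mul h1.continuous).integrable_of_hasCompactSupport h2.mul_left
  · exact (hg.continuous.mul hcφ).integrable_of_hasCompactSupport h2'.mul_left
  · exact (hg.continuous.mul h1.continuous).integrable_of_hasCompactSupport h2.mul_left

theorem memLp_apply {n : ℕ} {μ : Measure (EuclideanSpace ℝ (Fin n))} {p : ENNReal}
    {G : EuclideanSpace ℝ (Fin n) → EuclideanSpace ℝ (Fin n)} (hG : MemLp G p μ) (i : Fin n) :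
    MemLp (fun x => G x i) p μ :=
  hG.of_le ((EuclideanSpace.proj (𝕜 := ℝ) i).continuous.comp_aestronglyMeasurable hG.1)
    (ae_of_all _ fun x => PiLp.norm_apply_le (G x) i)

theorem memSobolevWith_of_contDiff {n : ℕ} {Ω : Set (EuclideanSpace ℝ (Fin n))} {p : ℝ}
    {g : EuclideanSpace ℝ (Fin n) → ℝ} (hg : ContDiff ℝ ∞ g) (hc : HasCompactSupport g) :
    MemSobolevWith Ω p g (gradient g) :=
  ⟨hg.continuous.memLp_of_hasCompactSupport hc,
    (continuous_gradient hg).memLp_of_hasCompactSupport (hasCompactSupport_gradient hc),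
    fun _ hφ i => integral_mul_gradient_eq_neg hφ hg i⟩

theorem memSobolevWith_one {n : ℕ} {Ω : Set (EuclideanSpace ℝ (Fin n))} (p : ℝ)
    (hΩ : volume Ω ≠ ⊤) : MemSobolevWith Ω p (fun _ => 1) (fun _ => 0) := by
  have : IsFiniteMeasure (volume.restrict Ω) := ⟨by simpa using hΩ.lt_top⟩
  refine ⟨memLp_const _, memLp_const _, fun φ hφ i => ?_⟩
  have := integral_mul_gradient_eq_neg hφ (contDiff_const (c := (1 : ℝ))) i
  simpa using this

/-- The integration by parts formula passes to limits of test functions. -/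
theorem integral_mul_eq_neg_of_tendsto {n : ℕ} {Ω : Set (EuclideanSpace ℝ (Fin n))} {p : ℝ}
    (hp : 1 < p) {u : EuclideanSpace ℝ (Fin n) → ℝ}
    {G : EuclideanSpace ℝ (Fin n) → EuclideanSpace ℝ (Fin n)}
    {φ : ℕ → EuclideanSpace ℝ (Fin n) → ℝ} (hφ : ∀ k, IsTestFunction Ω (φ k))
    (hu : MemLp u (ENNReal.ofReal p) (volume.restrict Ω))
    (hG : MemLp G (ENNReal.ofReal p) (volume.restrict Ω))
    (hφu : Tendsto (fun k => eLpNorm (fun x => φ k x - u x) (ENNReal.ofReal p)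
      (volume.restrict Ω)) atTop (𝓝 0))
    (hφG : Tendsto (fun k => eLpNorm (fun x => gradient (φ k) x - G x) (ENNReal.ofReal p)
        (volume.restrict Ω)) atTop (𝓝 0))
    {g : EuclideanSpace ℝ (Fin n) → ℝ}
    {Dg : EuclideanSpace ℝ (Fin n) → EuclideanSpace ℝ (Fin n)}
    (hg : MemSobolevWith Ω (p / (p - 1)) g Dg) (i : Fin n) :
    ∫ x in Ω, u x * Dg x i = -∫ x in Ω, G x i * g x := by
  have hpq : p.HolderConjugate (p / (p - 1)) := Real.HolderConjugate.conjExponent hp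
  have : (ENNReal.ofReal p).HolderConjugate (ENNReal.ofReal (p / (p - 1))) := hpq.ennrealOfReal
  have hφL : ∀ k, MemLp (φ k) (ENNReal.ofReal p) (volume.restrict Ω) := fun k =>
    (hφ k).1.continuous.memLp_of_hasCompactSupport (hφ k).2.1
  have hgL : ∀ k, MemLp (gradient (φ k)) (ENNReal.ofReal p) (volume.restrict Ω) := fun k =>
    (continuous_gradient (hφ k).1).memLp_of_hasCompactSupport
      (hasCompactSupport_gradient (hφ k).2.1)
  have h1 := tendsto_integral_mul_of_eLpNorm hφL hu (memLp_apply hg.2.1 i) hφu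
  have h2 : Tendsto (fun k => eLpNorm (fun x => gradient (φ k) x i - G x i) (ENNReal.ofReal p)
      (volume.restrict Ω)) atTop (𝓝 0) := by
    refine tendsto_of_tendsto_of_tendsto_of_le_of_le tendsto_const_nhds hφG
      (fun _ => zero_le) fun k => eLpNorm_mono fun x => ?_
    exact PiLp.norm_apply_le (gradient (φ k) x - G x) i
  have h3 := (tendsto_integral_mul_of_eLpNorm (fun k => memLp_apply (hgL k) i)
    (memLp_apply hG i) hg.1 h2).neg
  refine tendsto_nhds_unique h1 (h3.congr fun k => ?_)
  -- For a test function the formula is the definition of the weak gradient `Dg`, with the two sides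
  -- exchanged.
  have h4 := hg.2.2 (φ k) (hφ k) i
  rw [neg_eq_iff_eq_neg]
  simp only [mul_comm] at h4 ⊢
  exact h4

theorem IsTestFunction.sum {n : ℕ} {Ω : Set (EuclideanSpace ℝ (Fin n))}
    {ψ : ℕ → EuclideanSpace ℝ (Fin n) → ℝ} (hψ : ∀ k, IsTestFunction Ω (ψ k)) (K : ℕ) :
    IsTestFunction Ω (fun x => ∑ k ∈ Finset.range K, ψ k x) := by
  induction K with
  | zero =>
    simp only [Finset.range_zero, Finset.sum_empty]
    refine ⟨contDiff_const, HasCompactSupport.zero, by simp⟩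
  | succ K ih =>
    simp only [Finset.sum_range_succ]
    exact ⟨ih.1.add (hψ K).1, ih.2.1.add (hψ K).2.1,
      (tsupport_add _ _).trans (union_subset ih.2.2 (hψ K).2.2)⟩

theorem gradient_sum {n : ℕ} {ψ : ℕ → EuclideanSpace ℝ (Fin n) → ℝ}
    (hψ : ∀ k, ContDiff ℝ ∞ (ψ k)) (K : ℕ) (x : EuclideanSpace ℝ (Fin n)) :
    gradient (fun x => ∑ k ∈ Finset.range K, ψ k x) x =
      ∑ k ∈ Finset.range K, gradient (ψ k) x := by
  simp only [gradient]
  rw [fderiv_fun_sum fun k _ => ((hψ k).differentiable (by simp)).differentiableAt, map_sum]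

/-- At each point at most one term is nonzero, so no convergence question arises. -/
theorem hasSum_of_disjoint_tsupport {n : ℕ} {ψ : ℕ → EuclideanSpace ℝ (Fin n) → ℝ}
    (hd : ∀ j k, j ≠ k → Disjoint (tsupport (ψ j)) (tsupport (ψ k))) {F : Type*}
    [AddCommMonoid F] [TopologicalSpace F] {h : ℕ → EuclideanSpace ℝ (Fin n) → F}
    (hh : ∀ k x, x ∉ tsupport (ψ k) → h k x = 0) (x : EuclideanSpace ℝ (Fin n)) :
    HasSum (fun k => h k x) (∑' k, h k x) := by
  refine (summable_of_hasFiniteSupport (Set.Subsingleton.finite fun j hj k hk => ?_)).hasSum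
  by_contra hjk
  exact disjoint_left.1 (hd j k hjk) (not_imp_comm.1 (hh j x) hj) (not_imp_comm.1 (hh k x) hk)

/-- The sum of test functions with disjoint supports and summable Sobolev norms lies in
`W^{1,p}_0`, together with the integration by parts formula against `W^{1,q}`. -/
theorem memSobolevZero_series {n : ℕ} {Ω : Set (EuclideanSpace ℝ (Fin n))} {p : ℝ} (hp : 1 < p)
    {ψ : ℕ → EuclideanSpace ℝ (Fin n) → ℝ} (hψ : ∀ k, IsTestFunction Ω (ψ k))
    (hd : ∀ j k, j ≠ k → Disjoint (tsupport (ψ j)) (tsupport (ψ k))) {c : ℕ → ENNReal}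
    (hcs : ∑' k, c k ≠ ⊤) (h0 : ∀ k, eLpNorm (ψ k) (ENNReal.ofReal p) volume ≤ c k)
    (h1 : ∀ k, eLpNorm (gradient (ψ k)) (ENNReal.ofReal p) volume ≤ c k) :
    MemSobolevZero Ω p (fun x => ∑' k, ψ k x) ∧
    ∃ G : EuclideanSpace ℝ (Fin n) → EuclideanSpace ℝ (Fin n),
      MemLp (fun x => ∑' k, ψ k x) (ENNReal.ofReal p) (volume.restrict Ω) ∧
      MemLp G (ENNReal.ofReal p) (volume.restrict Ω) ∧
      ∀ (g : EuclideanSpace ℝ (Fin n) → ℝ)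
        (Dg : EuclideanSpace ℝ (Fin n) → EuclideanSpace ℝ (Fin n)),
        MemSobolevWith Ω (p / (p - 1)) g Dg → ∀ i,
          ∫ x in Ω, (∑' k, ψ k x) * Dg x i = -∫ x in Ω, G x i * g x := by
  have hp1 : 1 ≤ ENNReal.ofReal p := by simpa using hp.le
  have hS := hasSum_of_disjoint_tsupport hd (h := ψ)
    fun k x hx => image_eq_zero_of_notMem_tsupport hx
  have hSg := hasSum_of_disjoint_tsupport hd (h := fun k => gradient (ψ k))
    fun k x hx => gradient_eq_zero_of_notMem_tsupport hx
  have hm := fun k => ((hψ k).1.continuous.aestronglyMeasurable (μ := volume.restrict Ω))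
  have hmg := fun k =>
    ((continuous_gradient (hψ k).1).aestronglyMeasurable (μ := volume.restrict Ω))
  have h0' : ∀ k, eLpNorm (ψ k) (ENNReal.ofReal p) (volume.restrict Ω) ≤ c k := fun k =>
    (eLpNorm_mono_measure _ Measure.restrict_le_self).trans (h0 k)
  have h1' : ∀ k, eLpNorm (gradient (ψ k)) (ENNReal.ofReal p) (volume.restrict Ω) ≤ c k :=
    fun k => (eLpNorm_mono_measure _ Measure.restrict_le_self).trans (h1 k)
  have hu := memLp_series hp1 hm h0' hcs hS
  have hG := memLp_series hp1 hmg h1' hcs hSg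
  have tu := tendsto_eLpNorm_series hp1 hm h0' hcs hS
  have tG := tendsto_eLpNorm_series hp1 hmg h1' hcs hSg
  have hφ := IsTestFunction.sum hψ
  simp only [← gradient_sum fun k => (hψ k).1] at tG
  have key := fun g Dg hg i =>
    integral_mul_eq_neg_of_tendsto (g := g) (Dg := Dg) hp hφ hu hG tu tG hg i
  refine ⟨⟨_, ⟨hu, hG, fun φ hφ' i => ?_⟩, _, hφ, tu, tG⟩, _, hu, hG, key⟩
  -- Test functions are themselves in `W^{1,q}`, so the strong formula also shows that `G` is the
  -- weak gradient.
  exact key φ (gradient φ) (memSobolevWith_of_contDiff hφ'.1 hφ'.2.1) i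

theorem memSobolevZero_zero {n : ℕ} (Ω : Set (EuclideanSpace ℝ (Fin n))) (p : ℝ) :
    MemSobolevZero Ω p (fun _ => 0) := by
  have hg : gradient (fun _ : EuclideanSpace ℝ (Fin n) => (0 : ℝ)) = fun _ => 0 := by
    ext1 x; exact gradient_fun_const x 0
  refine ⟨fun _ => 0, ⟨MemLp.zero, MemLp.zero, by simp⟩, fun _ _ => 0, fun k => ?_, ?_, ?_⟩
  · simpa using IsTestFunction.sum (Ω := Ω) (ψ := fun _ _ => 0)
      (fun _ => ⟨contDiff_const, HasCompactSupport.zero, by simp⟩) 0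
  · simp
  · simp [hg]

/-! ### Arclength curves, the John condition and separation -/

theorem HasUnitSpeedOn.congr {V : Type*} [PseudoEMetricSpace V] {f g : ℝ → V} {s : Set ℝ}
    (hf : HasUnitSpeedOn f s) (h : EqOn g f s) : HasUnitSpeedOn g s := fun x hx y hy => by
  rw [eVariationOn.eq_of_eqOn (h.mono inter_subset_left)]
  exact hf hx hy

theorem HasUnitSpeedOn.dist_le {V : Type*} [PseudoMetricSpace V] {f : ℝ → V} {s : Set ℝ}
    (hf : HasUnitSpeedOn f s) {x y : ℝ} (hx : x ∈ s) (hy : y ∈ s) (hxy : x ≤ y) :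
    dist (f x) (f y) ≤ y - x := by
  have h1 := eVariationOn.edist_le f (s := s ∩ Icc x y) ⟨hx, left_mem_Icc.2 hxy⟩
    ⟨hy, right_mem_Icc.2 hxy⟩
  rw [hf hx hy, edist_dist, NNReal.coe_one, one_mul] at h1
  exact (ENNReal.ofReal_le_ofReal_iff (by linarith)).1 h1

theorem HasUnitSpeedOn.continuousOn {V : Type*} [PseudoMetricSpace V] {f : ℝ → V} {s : Set ℝ}
    (hf : HasUnitSpeedOn f s) : ContinuousOn f s := by
  refine LipschitzOnWith.continuousOn (K := 1) (LipschitzOnWith.of_dist_le_mul fun x hx y hy => ?_)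
  rw [NNReal.coe_one, one_mul, Real.dist_eq]
  rcases le_total x y with h | h
  · rw [abs_sub_comm, abs_of_nonneg (by linarith)]
    exact hf.dist_le hx hy h
  · rw [dist_comm, abs_of_nonneg (by linarith)]
    exact hf.dist_le hy hx h

/-- For `a ≠ b` the parametrisation is an isometry, so its variation is that of the identity. For `a
= b` the interval is a single point. -/
theorem hasUnitSpeedOn_segment {V : Type*} [NormedAddCommGroup V] [NormedSpace ℝ V] (a b : V)
    (t₀ : ℝ) : HasUnitSpeedOn (fun t => a + ((t - t₀) / dist a b) • (b - a))
      (Icc t₀ (t₀ + dist a b)) := by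
  by_cases hab : dist a b = 0
  · rw [hab, add_zero, Icc_self]
    exact hasConstantSpeedOnWith_of_subsingleton _ subsingleton_singleton _
  intro x hx y hy
  have h1 : eVariationOn (fun t => a + ((t - t₀) / dist a b) • (b - a))
      (Icc t₀ (t₀ + dist a b) ∩ Icc x y) = eVariationOn (id : ℝ → ℝ)
      (Icc t₀ (t₀ + dist a b) ∩ Icc x y) := by
    have : ∀ s t : ℝ, edist (a + ((s - t₀) / dist a b) • (b - a))
        (a + ((t - t₀) / dist a b) • (b - a)) = edist s t := by
      intro s t
      rw [edist_dist, edist_dist, dist_add_left, dist_eq_norm, ← sub_smul, norm_smul, ← dist_eq_norm b a,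
        dist_comm b a, Real.norm_eq_abs, Real.dist_eq s t, ← sub_div, sub_sub_sub_cancel_right, abs_div,
        abs_of_nonneg (dist_nonneg (x := a) (y := b)), div_mul_cancel₀ _ hab]
    simp only [eVariationOn, this, id]
  rw [h1, monotoneOn_id.eVariationOn_eq hx hy]
  simp

/-- The arclength parametrisation of the broken line through three points. -/
theorem exists_brokenLine {V : Type*} [NormedAddCommGroup V] [NormedSpace ℝ V] (a b c : V) :
    ∃ γ : ℝ → V, HasUnitSpeedOn γ (Icc 0 (dist a b + dist b c)) ∧ γ 0 = a ∧
      γ (dist a b + dist b c) = c ∧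
      ∀ t ∈ Icc 0 (dist a b + dist b c),
        (∃ s ∈ Icc (0 : ℝ) 1, γ t = a + s • (b - a) ∧ t ≤ s * dist a b) ∨
        (∃ s ∈ Icc (0 : ℝ) 1, γ t = b + s • (c - b)) := by
  set f₁ : ℝ → V := fun t => a + ((t - 0) / dist a b) • (b - a) with hf₁
  set f₂ : ℝ → V := fun t => b + ((t - dist a b) / dist b c) • (c - b) with hf₂
  have e₁ : ∀ x y : V, x + (dist x y / dist x y) • (y - x) = y := by
    intro x y
    by_cases h : dist x y = 0
    · rw [dist_eq_zero.1 h]; simp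
    · rw [div_self h]; simp
  have hmid : f₁ (dist a b) = b := by simp only [hf₁, sub_zero, e₁]
  have hmid' : f₂ (dist a b) = b := by simp [hf₂]
  let γ : ℝ → V := fun t => if t ≤ dist a b then f₁ t else f₂ t
  have h₁ : EqOn γ f₁ (Icc 0 (0 + dist a b)) := fun t ht =>
    if_pos (show t ≤ dist a b by simpa using ht.2)
  have h₂ : EqOn γ f₂ (Icc (dist a b) (dist a b + dist b c)) := by
    intro t ht
    rcases ht.1.eq_or_lt with h | h
    · rw [← h, hmid']; exact (if_pos (le_refl (dist a b))).trans hmid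
    · exact if_neg (show ¬ t ≤ dist a b from not_le.2 h)
  have hle : 0 ≤ dist a b := dist_nonneg
  have hle' : 0 ≤ dist b c := dist_nonneg
  refine ⟨γ, ?_, ?_, ?_, fun t ht => ?_⟩
  · have g₁ := (hasUnitSpeedOn_segment a b 0).congr h₁
    rw [zero_add] at g₁
    exact g₁.Icc_Icc ((hasUnitSpeedOn_segment b c (dist a b)).congr h₂)
  · rw [h₁ ⟨le_rfl, by simp⟩]; simp [hf₁]
  · rw [h₂ ⟨by linarith, le_rfl⟩]
    simp only [hf₂, add_sub_cancel_left, e₁]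
  · rcases le_total t (dist a b) with h | h
    · refine Or.inl ⟨t / dist a b, ⟨div_nonneg ht.1 hle, div_le_one_of_le₀ h hle⟩, ?_, ?_⟩
      · rw [h₁ ⟨ht.1, by simpa using h⟩]; simp [hf₁]
      · by_cases h0 : dist a b = 0
        · rw [h0] at h ⊢; simpa using h
        · rw [div_mul_cancel₀ _ h0]
    · refine Or.inr ⟨(t - dist a b) / dist b c, ⟨div_nonneg (by linarith) hle',
        div_le_one_of_le₀ (by linarith [ht.2]) hle'⟩, ?_⟩
      rw [h₂ ⟨h, ht.2⟩]

/-- Needed because `Metric.infDist` to the empty set is 0, which would break its monotonicity under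
inclusion. -/
theorem frontier_nonempty_of_compl {n : ℕ} {Ω : Set (EuclideanSpace ℝ (Fin n))}
    (h1 : Ω.Nonempty) (h2 : Ωᶜ.Nonempty) : (frontier Ω).Nonempty := by
  rw [nonempty_iff_ne_empty, Ne, ← isClopen_iff_frontier_eq_empty, isClopen_iff]
  rintro (h | h)
  · exact h1.ne_empty h
  · exact h2.ne_empty (by rw [h, compl_univ])

theorem infDist_compl_le_boundaryDist {n : ℕ} {Ω : Set (EuclideanSpace ℝ (Fin n))}
    (ho : IsOpen Ω) (h1 : Ω.Nonempty) (h2 : Ωᶜ.Nonempty) (x : EuclideanSpace ℝ (Fin n)) :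
    Metric.infDist x Ωᶜ ≤ boundaryDist Ω x := by
  refine Metric.infDist_le_infDist_of_subset ?_ (frontier_nonempty_of_compl h1 h2)
  rw [ho.frontier_eq]
  exact fun y hy => hy.2

theorem boundaryDist_pos {n : ℕ} {Ω : Set (EuclideanSpace ℝ (Fin n))}
    (ho : IsOpen Ω) (h2 : Ωᶜ.Nonempty) {x : EuclideanSpace ℝ (Fin n)} (hx : x ∈ Ω) :
    0 < boundaryDist Ω x :=
  ((ho.isClosed_compl.notMem_iff_infDist_pos h2).1 (not_not.2 hx)).trans_le
    (infDist_compl_le_boundaryDist ho ⟨x, hx⟩ h2 x)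

/-- A John curve satisfies the first alternative of the separation property at every time. -/
theorem IsJohnDomain.hasSeparationProperty {n : ℕ} {Ω : Set (EuclideanSpace ℝ (Fin n))}
    {x₀ : EuclideanSpace ℝ (Fin n)} (h : IsJohnDomain Ω x₀) (hc : Ωᶜ.Nonempty) :
    HasSeparationProperty Ω x₀ := by
  obtain ⟨ho, hconn, -, hx₀, C, hC, hJ⟩ := h
  -- Earlier points of the curve are within arclength `l * t ≤ ρ / C`; the factor 2 makes the
  -- inclusion in the open ball strict.
  refine ⟨ho, hconn, hx₀, 2 / C, by positivity, fun x hx => ?_⟩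
  obtain ⟨l, γ, hl, hγ, h0, h1, hd⟩ := hJ x hx
  have hmem : ∀ t ∈ Icc (0 : ℝ) 1, l * t ∈ Icc 0 l := fun t ht =>
    ⟨mul_nonneg hl ht.1, mul_le_of_le_one_right hl ht.2⟩
  refine ⟨fun t => γ (l * t), ?_, fun t ht => (hd _ (hmem t ht)).1, by simpa using h0,
    by simpa using h1, fun t ht => Or.inl ?_⟩
  · exact hγ.continuousOn.comp (by fun_prop) hmem
  · rintro _ ⟨s, hs, rfl⟩
    have hs' : s ∈ Icc (0 : ℝ) 1 := ⟨hs.1, hs.2.trans ht.2⟩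
    have h2 := hγ.dist_le (hmem s hs') (hmem t ht) (mul_le_mul_of_nonneg_left hs.2 hl)
    have h3 := (hd _ (hmem t ht)).2
    have h4 := infDist_compl_le_boundaryDist ho ⟨x, hx⟩ hc (γ (l * t))
    have h5 := boundaryDist_pos ho hc (hd _ (hmem t ht)).1
    have h6 := mul_nonneg hl hs.1
    rw [Metric.mem_ball, div_mul_eq_mul_div, lt_div_iff₀ hC]
    nlinarith

theorem le_infDist_ball_diff_compl {n : ℕ} {E : Set (EuclideanSpace ℝ (Fin n))}
    {y : EuclideanSpace ℝ (Fin n)} {d : ℝ} (hne : (Metric.ball 0 2 \ E)ᶜ.Nonempty)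
    (h1 : ‖y‖ + d ≤ 2) (h2 : ∀ z ∈ E, d ≤ dist y z) :
    d ≤ Metric.infDist y (Metric.ball 0 2 \ E)ᶜ := by
  refine (Metric.le_infDist hne).2 fun z hz => ?_
  by_cases hzE : z ∈ E
  · exact h2 z hzE
  · have hz2 : 2 ≤ ‖z‖ := by
      by_contra! h
      exact hz ⟨by simpa using h, hzE⟩
    have h3 := norm_sub_norm_le z y
    rw [dist_comm, dist_eq_norm]
    linarith

/-- Go from `x` to the unit vector `b` on its side of the hyperplane, then to `c = e₀`. At parameter
`s` of the first segment the height is at least `s` and the norm at most `2 - s`, so the distance to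
the complement is at least `s`, while the arclength is at most `3 s`. On the second segment the norm
lies between `1/2` and `1`, so the distance is at least `1/4`. The total length is at most 5, and
`5/24 ≤ 1/4`. -/
theorem exists_johnCurve {m : ℕ} {E : Set (EuclideanSpace ℝ (Fin (m + 2)))}
    (hE1 : ∀ x ∈ E, ‖x‖ ≤ 1 / 4) (hE2 : ∀ x ∈ E, x (Fin.last (m + 1)) = 0)
    (hne : (Metric.ball 0 2 \ E)ᶜ.Nonempty)
    {x : EuclideanSpace ℝ (Fin (m + 2))} (hx : x ∈ Metric.ball 0 2 \ E) :
    ∃ (l : ℝ) (γ : ℝ → EuclideanSpace ℝ (Fin (m + 2))),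
      0 ≤ l ∧ HasUnitSpeedOn γ (Icc 0 l) ∧ γ 0 = x ∧ γ l = EuclideanSpace.single 0 1 ∧
      ∀ t ∈ Icc 0 l, γ t ∈ Metric.ball 0 2 \ E ∧
        1 / 24 * t ≤ Metric.infDist (γ t) (Metric.ball 0 2 \ E)ᶜ := by
  have hmem : ∀ {y : EuclideanSpace ℝ (Fin (m + 2))} {d : ℝ}, 0 < d →
      d ≤ Metric.infDist y (Metric.ball 0 2 \ E)ᶜ → y ∈ Metric.ball 0 2 \ E := by
    intro y d hd h
    by_contra hy
    rw [Metric.infDist_zero_of_mem hy] at h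
    linarith
  obtain ⟨σ, hσ1, hσx⟩ : ∃ σ : ℝ, |σ| = 1 ∧ 0 ≤ σ * x (Fin.last (m + 1)) := by
    rcases le_total 0 (x (Fin.last (m + 1))) with h | h
    · exact ⟨1, by simp, by simpa using h⟩
    · exact ⟨-1, by simp, by simpa using h⟩
  have hσσ : σ * σ = 1 := by rw [← abs_mul_abs_self, hσ1, one_mul]
  set b : EuclideanSpace ℝ (Fin (m + 2)) := EuclideanSpace.single (Fin.last (m + 1)) σ with hb
  set c : EuclideanSpace ℝ (Fin (m + 2)) := EuclideanSpace.single 0 1 with hc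
  have hbn : ‖b‖ = 1 := by rw [hb, PiLp.norm_single, Real.norm_eq_abs, hσ1]
  have hcn : ‖c‖ = 1 := by rw [hc, PiLp.norm_single, norm_one]
  have hxn : ‖x‖ < 2 := by simpa using hx.1
  obtain ⟨γ, h1, h2, h3, h4⟩ := exists_brokenLine x b c
  have hl1 : dist x b ≤ 3 := by
    rw [dist_eq_norm]; linarith [norm_sub_le x b]
  have hl2 : dist b c ≤ 2 := by
    rw [dist_eq_norm]; linarith [norm_sub_le b c]
  refine ⟨_, γ, add_nonneg dist_nonneg dist_nonneg, h1, h2, h3, fun t ht => ?_⟩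
  rcases h4 t ht with ⟨s, hs, hγ, hts⟩ | ⟨s, hs, hγ⟩
  · rw [hγ]
    have key : s ≤ Metric.infDist (x + s • (b - x)) (Metric.ball 0 2 \ E)ᶜ := by
      refine le_infDist_ball_diff_compl hne ?_ fun z hz => ?_
      · have : x + s • (b - x) = (1 - s) • x + s • b := by module
        have h5 := norm_add_le ((1 - s) • x) (s • b)
        rw [norm_smul, norm_smul, Real.norm_of_nonneg hs.1,
          Real.norm_of_nonneg (by linarith [hs.2]), hbn] at h5
        rw [this]
        nlinarith [hs.2]
      · have h5 := PiLp.norm_apply_le (x + s • (b - x) - z) (Fin.last (m + 1))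
        rw [dist_eq_norm]
        refine le_trans ?_ h5
        have h6 : (x + s • (b - x) - z) (Fin.last (m + 1)) =
            (1 - s) * x (Fin.last (m + 1)) + s * σ := by
          simp [hE2 z hz, hb]; ring
        have h7 : ∀ r : ℝ, |r| = |σ * r| := fun r => by rw [abs_mul, hσ1, one_mul]
        rw [h6, Real.norm_eq_abs, h7]
        refine le_trans ?_ (le_abs_self _)
        have : σ * ((1 - s) * x (Fin.last (m + 1)) + s * σ) =
          (1 - s) * (σ * x (Fin.last (m + 1))) + s * (σ * σ) := by ring
        rw [this, hσσ, mul_one]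
        linarith [mul_nonneg (show 0 ≤ 1 - s by linarith [hs.2]) hσx]
    refine ⟨?_, ?_⟩
    -- At `s = 0` the distance bound is void, but the point is `x` itself.
    · rcases hs.1.eq_or_lt with h | h
      · rw [← h]; simpa using hx
      · exact hmem h key
    · have : s * dist x b ≤ s * 3 := mul_le_mul_of_nonneg_left hl1 hs.1
      linarith [hs.1]
  · rw [hγ]
    have hy0 : (b + s • (c - b)) 0 = s := by
      simp [hb, hc, Fin.ext_iff]
    have hy1 : (b + s • (c - b)) (Fin.last (m + 1)) = (1 - s) * σ := by
      simp [hb, hc, Fin.ext_iff]; ring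
    have hn1 := PiLp.norm_apply_le (b + s • (c - b)) 0
    have hn2 := PiLp.norm_apply_le (b + s • (c - b)) (Fin.last (m + 1))
    rw [hy0, Real.norm_of_nonneg hs.1] at hn1
    rw [hy1, norm_mul, Real.norm_eq_abs σ, hσ1, mul_one,
      Real.norm_of_nonneg (by linarith [hs.2])] at hn2
    have key : 1 / 4 ≤ Metric.infDist (b + s • (c - b)) (Metric.ball 0 2 \ E)ᶜ := by
      refine le_infDist_ball_diff_compl hne ?_ fun z hz => ?_
      · have : b + s • (c - b) = (1 - s) • b + s • c := by module
        have h5 := norm_add_le ((1 - s) • b) (s • c)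
        rw [norm_smul, norm_smul, Real.norm_of_nonneg hs.1,
          Real.norm_of_nonneg (by linarith [hs.2]), hbn, hcn] at h5
        rw [this]
        linarith
      · have h5 := norm_sub_norm_le (b + s • (c - b)) z
        have h6 := hE1 z hz
        rw [dist_eq_norm]
        linarith
    exact ⟨hmem (by norm_num) key, by linarith [ht.2]⟩

theorem isJohnDomain_ball_diff {m : ℕ} {E : Set (EuclideanSpace ℝ (Fin (m + 2)))}
    (hEc : IsClosed E) (hE1 : ∀ x ∈ E, ‖x‖ ≤ 1 / 4) (hE2 : ∀ x ∈ E, x (Fin.last (m + 1)) = 0)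
    (hne : (Metric.ball 0 2 \ E)ᶜ.Nonempty) :
    IsJohnDomain (Metric.ball 0 2 \ E) (EuclideanSpace.single 0 1) := by
  have hx₀ : (EuclideanSpace.single 0 1 : EuclideanSpace ℝ (Fin (m + 2))) ∈
      Metric.ball 0 2 \ E := by
    have h : ‖(EuclideanSpace.single 0 1 : EuclideanSpace ℝ (Fin (m + 2)))‖ = 1 := by
      rw [PiLp.norm_single, norm_one]
    refine ⟨by rw [mem_ball_zero_iff, h]; norm_num, fun hE => ?_⟩
    have := hE1 _ hE
    rw [h] at this
    norm_num at this
  refine ⟨Metric.isOpen_ball.sdiff hEc, ⟨⟨_, hx₀⟩, ?_⟩,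
    Metric.isBounded_ball.subset sdiff_subset, hx₀, 1 / 24, by norm_num,
    fun x hx => exists_johnCurve hE1 hE2 hne hx⟩
  refine isPreconnected_of_forall (EuclideanSpace.single 0 1) fun x hx => ?_
  obtain ⟨l, γ, hl, hγ, h0, h1, h2⟩ := exists_johnCurve hE1 hE2 hne hx
  refine ⟨γ '' Icc 0 l, ?_, ⟨l, right_mem_Icc.2 hl, h1⟩, ⟨0, left_mem_Icc.2 hl, h0⟩,
    isPreconnected_Icc.image _ hγ.continuousOn⟩
  rintro _ ⟨t, ht, rfl⟩
  exact (h2 t ht).1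

/-! ### The exceptional set -/

/-- The points accumulate only at the origin: the set is an intersection of unions of a finite set
and a small closed ball. -/
theorem isClosed_insert_iUnion {V : Type*} [NormedAddCommGroup V] {F : ℕ → Set V}
    (hF : ∀ k, (F k).Finite) (hn : ∀ k, ∀ x ∈ F k, ‖x‖ ≤ (1 / 2) ^ k) :
    IsClosed (insert 0 (⋃ k, F k)) := by
  have h : insert 0 (⋃ k, F k) =
      ⋂ K : ℕ, ((⋃ k ∈ Finset.range K, F k) ∪ Metric.closedBall 0 ((1 / 2) ^ K)) := by
    ext x
    simp only [mem_insert_iff, mem_iUnion, mem_iInter, mem_union, Finset.mem_range,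
      mem_closedBall_zero_iff, exists_prop]
    constructor
    · rintro (rfl | ⟨k, hk⟩) K
      · right; simp
      · rcases lt_or_ge k K with hkK | hkK
        · exact Or.inl ⟨k, hkK, hk⟩
        · exact Or.inr ((hn k x hk).trans
            (pow_le_pow_of_le_one (by norm_num) (by norm_num) hkK))
    · intro hx
      by_cases hx0 : x = 0
      · exact Or.inl hx0
      · obtain ⟨K, hK⟩ := exists_pow_lt_of_lt_one (norm_pos_iff.2 hx0)
          (show (1 / 2 : ℝ) < 1 by norm_num)
        rcases hx K with ⟨k, -, hk⟩ | hk
        · exact Or.inr ⟨k, hk⟩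
        · linarith
  rw [h]
  refine isClosed_iInter fun K => IsClosed.union ?_ Metric.isClosed_closedBall
  exact (Set.Finite.biUnion (Finset.finite_toSet _) fun k _ => hF k).isClosed

/-- A small shift off the hyperplane leaves `E`. This is what bounds `ρ` by the distance to each net
point. -/
theorem mem_frontier_ball_diff {m : ℕ} {E : Set (EuclideanSpace ℝ (Fin (m + 2)))}
    (hEc : IsClosed E) (hE1 : ∀ x ∈ E, ‖x‖ ≤ 1 / 4) (hE2 : ∀ x ∈ E, x (Fin.last (m + 1)) = 0)
    {x : EuclideanSpace ℝ (Fin (m + 2))} (hx : x ∈ E) :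
    x ∈ frontier (Metric.ball 0 2 \ E) := by
  rw [(Metric.isOpen_ball.sdiff hEc).frontier_eq]
  refine ⟨Metric.mem_closure_iff.2 fun ε hε => ?_, fun h => h.2 hx⟩
  have ht : 0 < min (ε / 2) 1 := lt_min (by linarith) one_pos
  have hn : ‖(EuclideanSpace.single (Fin.last (m + 1)) (min (ε / 2) 1) :
      EuclideanSpace ℝ (Fin (m + 2)))‖ = min (ε / 2) 1 := by
    rw [PiLp.norm_single, Real.norm_of_nonneg ht.le]
  refine ⟨x + EuclideanSpace.single (Fin.last (m + 1)) (min (ε / 2) 1), ⟨?_, fun h => ?_⟩, ?_⟩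
  · rw [mem_ball_zero_iff]
    refine (norm_add_le _ _).trans_lt ?_
    rw [hn]
    linarith [hE1 x hx, min_le_right (ε / 2) 1]
  · have := hE2 _ h
    simp [hE2 x hx] at this
    exact ht.ne' this
  · rw [dist_self_add_right, hn]
    linarith [min_le_left (ε / 2) 1]

/-- Disjoint balls centred on the hyperplane that shrink to the origin inside the positive
orthant. -/
theorem exists_disjoint_balls (m : ℕ) :
    ∃ (z : ℕ → EuclideanSpace ℝ (Fin (m + 2))) (r : ℕ → ℝ), (∀ k, 0 < r k) ∧
      (∀ k, z k (Fin.last (m + 1)) = 0) ∧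
      (∀ k, ∀ x ∈ Metric.ball (z k) (r k), ‖x‖ ≤ (1 / 2) ^ k * (1 / 4) ∧ x ≠ 0 ∧
        ∀ i, i ≠ Fin.last (m + 1) → x i ∈ Icc (0 : ℝ) 1) ∧
      ∀ j k, j ≠ k → Disjoint (Metric.ball (z j) (r j)) (Metric.ball (z k) (r k)) := by
  let w : EuclideanSpace ℝ (Fin (m + 2)) :=
    WithLp.toLp 2 fun i => if i = Fin.last (m + 1) then 0 else 1
  have hw : ∀ i, i ≠ Fin.last (m + 1) → w i = 1 := fun i hi => if_neg hi
  have hwn : 0 ≤ ‖w‖ := norm_nonneg w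
  -- Chosen so that centre norm plus radius is at most `(1/2)^k * β * (‖w‖ + 1) = (1/2)^k / 4`.
  obtain ⟨β, hβ, hβ1⟩ : ∃ β : ℝ, 0 < β ∧ β * (‖w‖ + 1) = 1 / 4 :=
    ⟨1 / (4 * (‖w‖ + 1)), by positivity, by field_simp⟩
  have hpow : ∀ k : ℕ, (0 : ℝ) < (1 / 2) ^ k := fun k => by positivity
  have hcoord : ∀ k, ∀ x ∈ Metric.ball (((1 / 2 : ℝ) ^ k * β) • w) ((1 / 2) ^ k * β / 4),
      ∀ i, i ≠ Fin.last (m + 1) →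
        3 / 4 * ((1 / 2) ^ k * β) < x i ∧ x i < 5 / 4 * ((1 / 2) ^ k * β) := by
    intro k x hx i hi
    have h1 := PiLp.norm_apply_le (x - ((1 / 2 : ℝ) ^ k * β) • w) i
    rw [← dist_eq_norm] at h1
    have h2 := abs_lt.1 (h1.trans_lt hx)
    rw [PiLp.sub_apply, PiLp.smul_apply, hw i hi, smul_eq_mul, mul_one] at h2
    constructor <;> linarith [h2.1, h2.2]
  have h0 : (0 : Fin (m + 2)) ≠ Fin.last (m + 1) := by simp [Fin.ext_iff]
  refine ⟨fun k => ((1 / 2 : ℝ) ^ k * β) • w, fun k => (1 / 2) ^ k * β / 4,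
    fun k => by positivity, fun k => by simp [w], fun k x hx => ⟨?_, ?_, ?_⟩, ?_⟩
  · have h1 := norm_sub_norm_le x (((1 / 2 : ℝ) ^ k * β) • w)
    rw [← dist_eq_norm, norm_smul, Real.norm_of_nonneg (by positivity)] at h1
    have h2 := Metric.mem_ball.1 hx
    have h3 : (1 / 2 : ℝ) ^ k * (β * (‖w‖ + 1)) = (1 / 2) ^ k * (1 / 4) := by rw [hβ1]
    have h4 := mul_pos (hpow k) hβ
    nlinarith
  · rintro rfl
    have h1 := (hcoord k 0 hx 0 h0).1
    have h4 := mul_pos (hpow k) hβ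
    simp only [PiLp.zero_apply] at h1
    linarith
  · intro i hi
    have h1 := hcoord k x hx i hi
    have h4 := mul_pos (hpow k) hβ
    have h5 : (1 / 2 : ℝ) ^ k ≤ 1 := pow_le_one₀ (by norm_num) (by norm_num)
    constructor
    · linarith
    · nlinarith
  -- The first coordinate separates the balls: `5/4 * 1/2 < 3/4`.
  · have key : ∀ j k : ℕ, j < k → Disjoint
        (Metric.ball (((1 / 2 : ℝ) ^ j * β) • w) ((1 / 2) ^ j * β / 4))
        (Metric.ball (((1 / 2 : ℝ) ^ k * β) • w) ((1 / 2) ^ k * β / 4)) := by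
      intro j k hjk
      refine disjoint_left.2 fun x hx hx' => ?_
      have h1 := hcoord j x hx 0 h0
      have h2 := hcoord k x hx' 0 h0
      have h3 : (1 / 2 : ℝ) ^ k ≤ (1 / 2) ^ (j + 1) :=
        pow_le_pow_of_le_one (by norm_num) (by norm_num) hjk
      rw [pow_succ] at h3
      have h4 := mul_pos (hpow j) hβ
      have h5 := mul_le_mul_of_nonneg_right h3 hβ.le
      linarith [h1.1, h2.2]
    intro j k hjk
    rcases lt_or_gt_of_ne hjk with h | h
    · exact key j k h
    · exact (key k j h).symm

/-! ### Assembly of the counterexample -/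

theorem mainTheorem8 (n : ℕ) (p : ℝ) (hp : 1 < p) (hpn : p ≤ (n : ℝ)) :
    ∃ E Ω : Set (EuclideanSpace ℝ (Fin n)),
      IsCompact E ∧ E ⊆ Metric.ball 0 2 ∧
      (∀ x ∈ E, ∀ i : Fin n,
        ((i : ℕ) + 1 < n → x i ∈ Set.Icc (0 : ℝ) 1) ∧ ((i : ℕ) + 1 = n → x i = 0)) ∧
      Ω = Metric.ball 0 2 \ E ∧
      (∃ x₀, IsJohnDomain Ω x₀ ∧ HasSeparationProperty Ω x₀) ∧
      ∃ (f : EuclideanSpace ℝ (Fin n) → ℝ)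
        (v : EuclideanSpace ℝ (Fin n) → EuclideanSpace ℝ (Fin n)),
        MemLpZero Ω p f ∧ (∀ i : Fin n, MemSobolevZero Ω p (fun x => v x i)) ∧
        IsDivSolution Ω p v f ∧
        eLpNorm (fun x => (boundaryDist Ω x)⁻¹ • v x) (ENNReal.ofReal p)
          (MeasureTheory.volume.restrict Ω) = ⊤ := by
  obtain ⟨m, rfl⟩ : ∃ m, n = m + 2 := by
    have : (1 : ℝ) < n := hp.trans_le hpn
    exact ⟨n - 2, by have : 1 < n := by exact_mod_cast this
                     omega⟩
  obtain ⟨z, r, hr, hz, hball, hdisj⟩ := exists_disjoint_balls m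
  choose F hF hFb ψ hψ hψ0 hψc hψs hψ1 hψ2 hψM using fun k : ℕ =>
    exists_local_profile (m := m + 1) hp hpn (z k) (hz k) (hr k)
      (ε := (2⁻¹ : ENNReal) ^ k) (by simp) (k : ℝ)
  set E : Set (EuclideanSpace ℝ (Fin (m + 2))) := insert 0 (⋃ k, F k) with hE
  have hFn : ∀ k, ∀ x ∈ F k, ‖x‖ ≤ (1 / 2) ^ k * (1 / 4) := fun k x hx =>
    (hball k x (hFb k x hx).1).1
  have hEc : IsClosed E := isClosed_insert_iUnion hF fun k x hx =>
    (hFn k x hx).trans (mul_le_of_le_one_right (by positivity) (by norm_num))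
  have hE1 : ∀ x ∈ E, ‖x‖ ≤ 1 / 4 := by
    rintro x (rfl | hx)
    · simp
    · obtain ⟨k, hk⟩ := mem_iUnion.1 hx
      exact (hFn k x hk).trans
        (mul_le_of_le_one_left (by norm_num) (pow_le_one₀ (by norm_num) (by norm_num)))
  have hE2 : ∀ x ∈ E, x (Fin.last (m + 1)) = 0 := by
    rintro x (rfl | hx)
    · simp
    · obtain ⟨k, hk⟩ := mem_iUnion.1 hx
      exact (hFb k x hk).2
  have hE3 : ∀ x ∈ E, ∀ i, i ≠ Fin.last (m + 1) → x i ∈ Icc (0 : ℝ) 1 := by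
    rintro x (rfl | hx) i hi
    · simp
    · obtain ⟨k, hk⟩ := mem_iUnion.1 hx
      exact (hball k x (hFb k x hk).1).2.2 i hi
  set Ω : Set (EuclideanSpace ℝ (Fin (m + 2))) := Metric.ball 0 2 \ E with hΩ
  have hΩo : IsOpen Ω := Metric.isOpen_ball.sdiff hEc
  have hne : Ωᶜ.Nonempty := ⟨0, fun h => h.2 (mem_insert _ _)⟩
  have hJ : IsJohnDomain Ω (EuclideanSpace.single 0 1) :=
    isJohnDomain_ball_diff hEc hE1 hE2 hne
  have hEb : E ⊆ Metric.ball 0 2 := fun x hx => by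
    rw [mem_ball_zero_iff]; linarith [hE1 x hx]
  have hΩv : volume Ω ≠ ⊤ := ((measure_mono sdiff_subset).trans_lt measure_ball_lt_top).ne
  -- The `k`-th bump avoids its own net by construction, and the other nets and the origin because
  -- it stays in its ball.
  have hψΩ : ∀ k, tsupport (ψ k) ⊆ Ω := by
    intro k x hx
    obtain ⟨hxb, hxF⟩ := hψs k hx
    have h1 := hball k x hxb
    refine ⟨?_, ?_⟩
    · rw [mem_ball_zero_iff]
      have : (1 / 2 : ℝ) ^ k ≤ 1 := pow_le_one₀ (by norm_num) (by norm_num)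
      linarith [h1.1]
    · rintro (h0 | h0)
      · exact h1.2.1 h0
      · obtain ⟨j, hj⟩ := mem_iUnion.1 h0
        by_cases hjk : j = k
        · exact hxF (hjk ▸ hj)
        · exact disjoint_left.1 (hdisj j k hjk) (hFb j x hj).1 hxb
  have hψt : ∀ k, IsTestFunction Ω (ψ k) := fun k => ⟨hψ k, hψc k, hψΩ k⟩
  have hψd : ∀ j k, j ≠ k → Disjoint (tsupport (ψ j)) (tsupport (ψ k)) := fun j k hjk =>
    (hdisj j k hjk).mono (fun x hx => (hψs j hx).1) (fun x hx => (hψs k hx).1)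
  obtain ⟨hu0, G, hu, hG, hdiv⟩ := memSobolevZero_series hp hψt hψd (c := fun k => 2⁻¹ ^ k)
    (by rw [ENNReal.tsum_geometric]; simp) hψ1 hψ2
  -- Since the bumps are nonnegative, `u` dominates each of them and inherits every lower bound on
  -- Hardy quotients.
  set u : EuclideanSpace ℝ (Fin (m + 2)) → ℝ := fun x => ∑' k, ψ k x with hu_def
  have hψu : ∀ k x, ψ k x ≤ u x := fun k x =>
    le_hasSum (hasSum_of_disjoint_tsupport hψd (h := ψ)
      (fun k x hx => image_eq_zero_of_notMem_tsupport hx) x) k fun j _ => hψ0 j x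
  have hvn : ∀ x, ‖(EuclideanSpace.single 0 (u x) : EuclideanSpace ℝ (Fin (m + 2)))‖ = ‖u x‖ :=
    fun x => by rw [PiLp.norm_single]
  refine ⟨E, Ω, (isCompact_closedBall 0 (1 / 4)).of_isClosed_subset hEc
    fun x hx => mem_closedBall_zero_iff.2 (hE1 x hx), hEb, fun x hx i => ⟨fun hi => ?_, fun hi => ?_⟩,
    rfl, ⟨_, hJ, hJ.hasSeparationProperty hne⟩, fun x => G x 0,
    fun x => EuclideanSpace.single 0 (u x), ⟨memLp_apply hG 0, ?_⟩, fun i => ?_, ⟨?_, ?_⟩, ?_⟩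
  · exact hE3 x hx i fun h => by simp [h] at hi
  · rw [show i = Fin.last (m + 1) from Fin.ext (by simpa using hi)]
    exact hE2 x hx
  · have := hdiv _ _ (memSobolevWith_one _ hΩv) 0
    simpa using this
  · by_cases hi : i = 0
    · subst hi
      simpa using hu0
    · simpa [hi] using memSobolevZero_zero Ω p
  · refine hu.of_le ?_ (ae_of_all _ fun x => (hvn x).le)
    refine (Continuous.comp_aestronglyMeasurable (g := fun t : ℝ =>
      (EuclideanSpace.single 0 t : EuclideanSpace ℝ (Fin (m + 2)))) ?_ hu.1)
    have : ∀ t : ℝ, t • (EuclideanSpace.single 0 1 : EuclideanSpace ℝ (Fin (m + 2))) =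
        EuclideanSpace.single 0 t := fun t => by
      ext i; by_cases hi : i = 0 <;> simp [hi]
    exact (continuous_id.smul continuous_const).congr this
  · intro g Dg hg
    rw [← hdiv g Dg hg 0]
    congr 1
    ext x
    rw [EuclideanSpace.inner_single_left]
    simp [hu_def]
  -- A finite norm would lie below some natural number `k`, contradicting the bound from the `k`-th
  -- bump.
  · by_contra htop
    obtain ⟨k, hk⟩ := ENNReal.exists_nat_gt htop
    refine absurd (hψM k (boundaryDist Ω) ?_ ?_) (not_le.2 (lt_of_le_of_lt ?_ (by simpa using hk)))
    · exact fun x hx => boundaryDist_pos hΩo hne (hψΩ k hx)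
    · exact fun x a ha => Metric.infDist_le_dist_of_mem (mem_frontier_ball_diff hEc hE1 hE2
        (mem_insert_of_mem _ (mem_iUnion.2 ⟨k, ha⟩)))
    · rw [← eLpNorm_restrict_eq_of_support_subset (s := Ω)]
      · refine eLpNorm_mono fun x => ?_
        rw [norm_smul, hvn, norm_mul, Real.norm_of_nonneg (hψ0 k x),
          Real.norm_of_nonneg ((hψ0 k x).trans (hψu k x))]
        exact mul_le_mul_of_nonneg_left (hψu k x) (norm_nonneg _)
      · exact fun x hx => hψΩ k (subset_tsupport _ (right_ne_zero_of_mul hx))
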